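/- **Model.** Let $\alpha,\beta,\delta,\nu>0$, let $\Phi\in C^1(0,1)$ with $\Phi'>0$ and $\kappa\in C^1(\mathbb R)$ with $\kappa'>0$. For an interest rate $r$ consider the Keen system $$\dot\omega=\omega[\Phi(\lambda)-\alpha],\quad \dot\lambda=\lambda\Big[\tfrac{\kappa(\pi)}{\nu}-\alpha-\beta-\delta\Big],\quad \dot d=d\Big[r-\tfrac{\kappa(\pi)}{\nu}+\delta\Big]+\kappa(\pi)-(1-\omega),\qquad \pi=1-\omega-rd .$$ Let $F_0(\omega,\lambda)=\big(\omega(\Phi(\lambda)-\alpha),\ \lambda(\kappa(1-\omega)/\nu-\alpha-\beta-\delta)\big)$ be the planar field at $r=0$. **Cycles.** Let $\mathcal I\subset\mathbb R$ be open, let $X(\theta;I)=(\omega(\theta;I),\lambda(\theta;I))$ be $C^2$ on $\mathbb R\times\mathcal I$, $2\pi$-periodic in $\theta$, with $\omega>0$ and $0<\lambda<1$, and let $\Omega\in C^2(\mathcal I)$, $\Omega>0$, be such that $\Omega(I)\,\partial_\theta X=F_0(X)$. Assume that $\partial_\theta X,\partial_I X$ are linearly independent everywhere and that $\kappa$ is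 $C^2$ near every value $1-\omega(\theta;I)$. Let $d_0(\cdot\,;I)$ denote the $2\pi$-periodic solution of $$\Omega(I)\,\partial_\theta d_0=\Big(\delta-\tfrac{\kappa(1-\omega)}{\nu}\Big)d_0+\kappa(1-\omega)-(1-\omega)$$ along the cycle, and put $$G(\theta;I)=\Big(0,\,-\tfrac1\nu\,\lambda\,\kappa'(1-\omega)\,d_0\Big)\Big|_{(\theta;I)} .$$ **Adjoint modes.** Let $J_0(\theta;I)=DF_0(X(\theta;I))$ and $\langle u,v\rangle_{L^2}=\frac1{2\pi}\int_0^{2\pi}u\cdot v\,d\theta$. The adjoint amplitude mode $Z^I$ and the adjoint phase mode $Z^\theta$ are the $2\pi$-periodic solutions of $$\Omega(I)\,\partial_\theta Z^I+J_0^\top Z^I=0,\qquad \langle Z^I,\partial_\theta X\rangle_{L^2}=0,\quad \langle Z^I,\partial_I X\rangle_{L^2}=1,$$ $$\Omega(I)\,\partial_\theta Z^\theta+J_0^\top Z^\theta=\Omega'(I)\,Z^I,\qquad \langle Z^\theta,\partial_\theta X\rangle_{L^2}=1,\quad \langle Z^\theta,\partial_I X\rangle_{L^2}=0 .$$ Define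 $$\Omega_1(I)=\frac1{2\pi}\int_0^{2\pi}Z^\theta(\theta;I)\cdot G(\theta;I)\,d\theta,\qquad S_1(I)=\frac1{2\pi}\int_0^{2\pi}Z^I(\theta;I)\cdot G(\theta;I)\,d\theta .$$ **Phase--amplitude equation.** A curve $(\theta(t),I(t))$ satisfies the phase--amplitude equation with remainder constant $C$ at the times $t\in s$ if $\theta$ and $I$ are differentiable at each $t\in s$ and there $$\big\|\partial_\theta X(\theta;I)\,(\dot\theta-\Omega(I))+\partial_I X(\theta;I)\,\dot I-r\,G(\theta;I)\big\|\le C\,r^2 .$$ **Proposition.** For every $I\in\mathcal I$ the function $d_0(\cdot\,;I)$ and the modes $Z^\theta(\cdot\,;I),Z^I(\cdot\,;I)$ exist and are unique. Moreover, in (1)--(3) below, $[a,b]\subset\mathcal I$ and $C$ are arbitrary, the constants $C'$ and $r_0>0$ depend on $a,b,C$ (and the model and family) but not on $r$ or on the curve, $s$ is any set of times, and all curves have $I(t)\in[a,b]$ for $t\in s$. 1. There are $C',r_0$ such that for $|r|<r_0$ the following holds. If $\theta,I$ are differentiable at the times in $s$, $\big(X(\theta(t);I(t)),d(t)\big)$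 satisfies the Keen system there, and $|d(t)-d_0(\theta(t);I(t))|\le C|r|$ there, then $(\theta,I)$ satisfies the phase--amplitude equation on $s$ with remainder constant $C'$. 2. There is $C'$ such that for every $r$, every curve satisfying the phase--amplitude equation on $s$ with remainder constant $C$ satisfies on $s$ $$|\dot\theta-\Omega(I)-r\,Z^\theta(\theta;I)\cdot G(\theta;I)|\le C'r^2,\qquad |\dot I-r\,Z^I(\theta;I)\cdot G(\theta;I)|\le C'r^2 .$$ 3. There are $C^1$ functions $w(\theta,I),u(\theta,I)$ on $\mathbb R\times\mathcal I$, $2\pi$-periodic in $\theta$ with zero phase average and independent of $a,b,C,r$ and of the curve, such that for suitable $C',r_0$ and all $|r|<r_0$ the map $(\theta,I)\mapsto(\theta-r\,w(\theta,I),\,I-r\,u(\theta,I))$ is injective on $\mathbb R\times[a,b]$, and for every curve satisfying the phase--amplitude equation on $s$ with remainder constant $C$, the near-identity variables $\bar\theta=\theta-r\,w(\theta,I)$, $\bar I=I-r\,u(\theta,I)$ are differentiable at the times in $s$, with $\bar I\in\mathcal I$, and obey there the effective equations $$|\dot{\bar\theta}-\Omega(\bar I)-r\,\Omega_1(\bar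 I)|\le C'r^2,\qquad |\dot{\bar I}-r\,S_1(\bar I)|\le C'r^2 .$$ -/

import Mathlib

open Real Set Matrix

noncomputable section

/-- The structural data of the Keen--Goodwin model: productivity growth `α`, labour force growth
`β`, depreciation `δ`, capital-output ratio `ν`, Phillips curve `Φ` on `(0,1)` and investment
function `κ`. -/
structure KeenModel where
  α : ℝ
  β : ℝ
  δ : ℝ
  ν : ℝ
  Φ : ℝ → ℝ
  κ : ℝ → ℝ
  α_pos : 0 < α
  β_pos : 0 < β
  δ_pos : 0 < δ
  ν_pos : 0 < ν
  Φ_contDiff : ContDiffOn ℝ 1 Φ (Ioo 0 1)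
  Φ_deriv_pos : ∀ x ∈ Ioo (0 : ℝ) 1, 0 < deriv Φ x
  κ_contDiff : ContDiff ℝ 1 κ
  κ_deriv_pos : ∀ x, 0 < deriv κ x

/-- The curve `(ω, lam, d)` satisfies the three-dimensional Keen system with real interest rate `r`
at all times in `s`; the profit share is `1 - ω - r d`. -/
def SolvesKeen (m : KeenModel) (r : ℝ) (ω lam d : ℝ → ℝ) (s : Set ℝ) : Prop :=
  ∀ t ∈ s,
    HasDerivAt ω (ω t * (m.Φ (lam t) - m.α)) t ∧
    HasDerivAt lam
      (lam t * (m.κ (1 - ω t - r * d t) / m.ν - m.α - m.β - m.δ)) t ∧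
    HasDerivAt d
      (d t * (r - m.κ (1 - ω t - r * d t) / m.ν + m.δ)
        + m.κ (1 - ω t - r * d t) - (1 - ω t)) t

/-- The planar (Goodwin) vector field at zero interest, in the variables `x = (ω, lam)`. -/
def F₀ (m : KeenModel) (x : Fin 2 → ℝ) : Fin 2 → ℝ :=
  ![x 0 * (m.Φ (x 1) - m.α), x 1 * (m.κ (1 - x 0) / m.ν - m.α - m.β - m.δ)]

/-- The Jacobian matrix of the planar vector field. -/
def J₀ (m : KeenModel) (x : Fin 2 → ℝ) : Matrix (Fin 2) (Fin 2) ℝ :=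
  LinearMap.toMatrix' (fderiv ℝ (F₀ m) x : (Fin 2 → ℝ) →ₗ[ℝ] (Fin 2 → ℝ))

/-- The first-order forcing produced by the interest rate at `x = (ω, lam)` and debt ratio `d`. -/
def forcing (m : KeenModel) (x : Fin 2 → ℝ) (d : ℝ) : Fin 2 → ℝ :=
  ![0, -(x 1 * deriv m.κ (1 - x 0) * d / m.ν)]

/-- The partial derivative of `X (θ; I)` in the phase `θ`. -/
def dPhase (X : ℝ → ℝ → Fin 2 → ℝ) (θ I : ℝ) : Fin 2 → ℝ := deriv (fun θ' => X θ' I) θ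

/-- The partial derivative of `X (θ; I)` in the amplitude `I`. -/
def dAmp (X : ℝ → ℝ → Fin 2 → ℝ) (θ I : ℝ) : Fin 2 → ℝ := deriv (fun I' => X θ I') I

/-- `X (θ; I)`, with `I` in the open set `𝓘`, is a smooth family of cycles of the planar system at
zero interest, parametrized by phase `θ` and amplitude `I`, with angular frequency `Ω I`
(so that the period is `2 π / Ω I`), and `(θ, I)` are regular local coordinates. -/
structure IsGoodwinFamily (m : KeenModel) (𝓘 : Set ℝ) (X : ℝ → ℝ → Fin 2 → ℝ) (Ω : ℝ → ℝ) :
    Prop where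
  isOpen : IsOpen 𝓘
  contDiffOn : ContDiffOn ℝ 2 (fun p : ℝ × ℝ => X p.1 p.2) (univ ×ˢ 𝓘)
  contDiffOn_freq : ContDiffOn ℝ 2 Ω 𝓘
  freq_pos : ∀ I ∈ 𝓘, 0 < Ω I
  periodic : ∀ I ∈ 𝓘, Function.Periodic (fun θ => X θ I) (2 * π)
  cycle : ∀ I ∈ 𝓘, ∀ θ, Ω I • dPhase X θ I = F₀ m (X θ I)
  wage_pos : ∀ I ∈ 𝓘, ∀ θ, 0 < X θ I 0
  employment_mem : ∀ I ∈ 𝓘, ∀ θ, X θ I 1 ∈ Ioo (0 : ℝ) 1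
  regular : ∀ I ∈ 𝓘, ∀ θ, LinearIndependent ℝ ![dPhase X θ I, dAmp X θ I]
  κ_contDiffAt : ∀ I ∈ 𝓘, ∀ θ, ContDiffAt ℝ 2 m.κ (1 - X θ I 0)

/-- `d` is the debt component of the zero-interest cycle of amplitude `I`: the `2 π`-periodic
solution of the debt equation along that cycle. -/
def IsCycleDebt (m : KeenModel) (X : ℝ → ℝ → Fin 2 → ℝ) (Ω : ℝ → ℝ) (I : ℝ) (d : ℝ → ℝ) : Prop :=
  Differentiable ℝ d ∧ Function.Periodic d (2 * π) ∧
    ∀ θ, Ω I * deriv d θ =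
      (m.δ - m.κ (1 - X θ I 0) / m.ν) * d θ + (m.κ (1 - X θ I 0) - (1 - X θ I 0))

/-- The forcing `G (θ; I)` along the zero-interest cycle and its debt component `d₀`. -/
def cycleForcing (m : KeenModel) (X : ℝ → ℝ → Fin 2 → ℝ) (d₀ : ℝ → ℝ → ℝ) (θ I : ℝ) : Fin 2 → ℝ :=
  forcing m (X θ I) (d₀ θ I)

/-- The average of a function of the phase over one period. -/
def phaseAvg (f : ℝ → ℝ) : ℝ := (2 * π)⁻¹ * ∫ θ in (0 : ℝ)..(2 * π), f θ

/-- The `L²` inner product of two `2 π`-periodic vector-valued functions. -/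
def innerL2 (u v : ℝ → Fin 2 → ℝ) : ℝ := phaseAvg fun θ => u θ ⬝ᵥ v θ

/-- `Z` is the adjoint amplitude mode of the cycle of amplitude `I`. -/
def IsAmplitudeMode (m : KeenModel) (X : ℝ → ℝ → Fin 2 → ℝ) (Ω : ℝ → ℝ) (I : ℝ)
    (Z : ℝ → Fin 2 → ℝ) : Prop :=
  Differentiable ℝ Z ∧ Function.Periodic Z (2 * π) ∧
    (∀ θ, Ω I • deriv Z θ + (J₀ m (X θ I))ᵀ *ᵥ Z θ = 0) ∧
    innerL2 Z (fun θ => dPhase X θ I) = 0 ∧ innerL2 Z (fun θ => dAmp X θ I) = 1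

/-- `Z` is the adjoint phase mode of the cycle of amplitude `I`, where `ZI` is the amplitude mode.
The right-hand side `Ω' ZI` accounts for the dependence of the frequency on the amplitude; where
`Ω'` vanishes, this is the homogeneous adjoint equation. Where `Ω'` does not vanish, the
homogeneous equation has no periodic solution with this normalization. -/
def IsPhaseMode (m : KeenModel) (X : ℝ → ℝ → Fin 2 → ℝ) (Ω : ℝ → ℝ) (I : ℝ)
    (ZI Z : ℝ → Fin 2 → ℝ) : Prop :=
  Differentiable ℝ Z ∧ Function.Periodic Z (2 * π) ∧
    (∀ θ, Ω I • deriv Z θ + (J₀ m (X θ I))ᵀ *ᵥ Z θ = deriv Ω I • ZI θ) ∧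
    innerL2 Z (fun θ => dPhase X θ I) = 1 ∧ innerL2 Z (fun θ => dAmp X θ I) = 0

/-- `(θ, I)` satisfies, at all times in `s`, the phase--amplitude equation
`∂_θ X (θ' - Ω) + ∂_I X I' = r G + O(r²)`, with remainder at most `C r²`. -/
def SolvesPhaseAmplitude (m : KeenModel) (X : ℝ → ℝ → Fin 2 → ℝ) (Ω : ℝ → ℝ) (d₀ : ℝ → ℝ → ℝ)
    (r C : ℝ) (θ I : ℝ → ℝ) (s : Set ℝ) : Prop :=
  ∀ t ∈ s, DifferentiableAt ℝ θ t ∧ DifferentiableAt ℝ I t ∧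
    ‖(deriv θ t - Ω (I t)) • dPhase X (θ t) (I t) + deriv I t • dAmp X (θ t) (I t)
      - r • cycleForcing m X d₀ (θ t) (I t)‖ ≤ C * r ^ 2

/-- The phase average of the forcing projected onto a mode: the coefficient `Ω₁` (for the phase
mode) and `S₁` (for the amplitude mode). -/
def avgProjection (m : KeenModel) (X : ℝ → ℝ → Fin 2 → ℝ) (d₀ : ℝ → ℝ → ℝ)
    (Z : ℝ → ℝ → Fin 2 → ℝ) (I : ℝ) : ℝ :=
  phaseAvg fun θ => Z θ I ⬝ᵥ cycleForcing m X d₀ θ I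

/-- `v (θ, I)` is a `C¹` corrector on `𝓘`: `2 π`-periodic in the phase, with zero phase average. -/
structure IsCorrector (𝓘 : Set ℝ) (v : ℝ → ℝ → ℝ) : Prop where
  contDiffOn : ContDiffOn ℝ 1 (fun p : ℝ × ℝ => v p.1 p.2) (univ ×ˢ 𝓘)
  periodic : ∀ I ∈ 𝓘, Function.Periodic (fun θ => v θ I) (2 * π)
  avg_eq_zero : ∀ I ∈ 𝓘, phaseAvg (fun θ => v θ I) = 0

end

/-! The adjoint modes are the basis dual to `(∂_θ X, ∂_I X)`. Differentiating `Ω ∂_θ X = F₀(X)` in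
`θ` and in `I` gives the variational equations `Ω ∂_θ(∂_θ X) = DF₀ ∂_θ X` and `Ω ∂_θ(∂_I X) = DF₀
∂_I X - Ω' ∂_θ X`. Pairing them with the adjoint equations shows that `Z ⬝ ∂_θ X` and `Z ⬝ ∂_I X`
are constant in the phase, the source `Ω' Z^I` cancelling the term `-Ω' ∂_θ X`. The averaged
normalizations are therefore pointwise ones, which gives existence, uniqueness and `C¹` dependence
on `(θ, I)` from an explicit formula (`IsAmplitudeMode.eq_dualSnd`, `IsPhaseMode.eq_dualFst`).

The debt equation becomes dissipative for total debt `e = λ d₀`: the investment terms cancel and `Ω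
e' = -(α + β) e + λ (κ - (1 - ω))`. A scalar equation with constant negative rate has exactly one
periodic solution, again `C¹` in `I`.

Given this, (1) is a Taylor expansion of `κ`, uniform by compactness and periodicity, and (2) is
pairing with the dual basis. For (3), put `f = Z^θ ⬝ G` and `g = Z^I ⬝ G`; the correctors solve `Ω
∂_θ u = g - S₁` and `Ω ∂_θ w = f - Ω₁ + Ω' u`. The term `Ω' u` is needed because `Ω` is evaluated at
the shifted amplitude `I - r u`. All first-order oscillating terms then cancel and the rest is
`O(r²)`. -/

noncomputable section

/-! ### Parameter integrals and uniform estimates over compact amplitude ranges. -/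

theorem contDiffOn_intervalIntegral_param {E : Type*} [NormedAddCommGroup E] [NormedSpace ℝ E]
    [ProperSpace E] {U : Set E} (hU : IsOpen U) {h : ℝ → E → ℝ}
    (hh : ContDiffOn ℝ 1 (fun p : ℝ × E => h p.1 p.2) (univ ×ˢ U)) (a b : ℝ) :
    ContDiffOn ℝ 1 (fun x => ∫ s in a..b, h s x) U := by
  have hV : IsOpen ((univ : Set ℝ) ×ˢ U) := isOpen_univ.prod hU
  set h' : E → ℝ → (E →L[ℝ] ℝ) := fun x s =>
    (fderiv ℝ (fun p : ℝ × E => h p.1 p.2) (s, x)).comp (ContinuousLinearMap.inr ℝ ℝ E) with hh'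
  have hd : ∀ s, ∀ x ∈ U, HasFDerivAt (fun x => h s x) (h' x s) x := by
    intro s x hx
    have h1 := ((hh.contDiffAt (x := (s, x)) (hV.mem_nhds ⟨mem_univ s, hx⟩)).differentiableAt
      one_ne_zero).hasFDerivAt
    exact h1.comp x (hasFDerivAt_prodMk_right s x)
  have hc' : ContinuousOn (fun p : ℝ × E => h' p.2 p.1) (univ ×ˢ U) := by
    have := hh.continuousOn_fderiv_of_isOpen hV le_rfl
    exact this.clm_comp continuousOn_const
  have hc0 : ∀ x ∈ U, Continuous (fun s => h s x) := by
    intro x hx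
    exact continuousOn_univ.mp (hh.continuousOn.comp (f := fun s : ℝ => (s, x)) (by fun_prop)
      (fun s _ => ⟨mem_univ _, hx⟩))
  have hc1 : ∀ x ∈ U, Continuous (fun s => h' x s) := by
    intro x hx
    exact continuousOn_univ.mp (hc'.comp (f := fun s : ℝ => (s, x)) (by fun_prop)
      (fun s _ => ⟨mem_univ _, hx⟩))
  have hF : ∀ x ∈ U, HasFDerivAt (fun x => ∫ s in a..b, h s x) (∫ s in a..b, h' x s) x := by
    intro x hx
    obtain ⟨ε, hε, hball⟩ := Metric.nhds_basis_closedBall.mem_iff.mp (hU.mem_nhds hx)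
    -- Closed balls are compact in a proper space, so a constant dominates the derivative near `x`.
    obtain ⟨M, hM⟩ := (isCompact_uIcc.prod (isCompact_closedBall x ε)).exists_bound_of_continuousOn
      (hc'.mono (prod_mono (subset_univ (uIcc a b)) hball))
    refine intervalIntegral.hasFDerivAt_integral_of_dominated_of_fderiv_le (F' := h')
      (s := Metric.closedBall x ε) (bound := fun _ => M) (Metric.closedBall_mem_nhds x hε) ?_ ?_ ?_
      ?_ ?_ ?_
    · filter_upwards [hU.mem_nhds hx] with y hy
      exact (hc0 y hy).aestronglyMeasurable
    · exact (hc0 x hx).intervalIntegrable _ _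
    · exact (hc1 x hx).aestronglyMeasurable
    · exact Filter.Eventually.of_forall fun t ht y hy => hM (t, y) ⟨uIoc_subset_uIcc ht, hy⟩
    · exact intervalIntegrable_const
    · exact Filter.Eventually.of_forall fun t _ y hy => hd t y (hball hy)
  have hcF : ContinuousOn (fun x => ∫ s in a..b, h' x s) U := by
    rw [continuousOn_iff_continuous_domRestrict]
    refine intervalIntegral.continuous_parametric_intervalIntegral_of_continuous'
      (f := fun (x : U) s => h' x s) ?_ a b
    exact hc'.comp_continuous (f := fun p : U × ℝ => (p.2, (p.1 : E))) (by fun_prop)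
      (fun p => ⟨mem_univ _, p.1.2⟩)
  rw [show (1 : WithTop ℕ∞) = 0 + 1 by simp, contDiffOn_succ_iff_fderiv_of_isOpen hU]
  refine ⟨fun x hx => (hF x hx).differentiableAt.differentiableWithinAt, by simp, ?_⟩
  rw [contDiffOn_zero]
  exact hcF.congr fun x hx => (hF x hx).fderiv

/-- Rescaling the integration variable by the endpoint makes the limits fixed, so joint smoothness
in endpoint and parameter reduces to differentiation under the integral. -/
theorem contDiffOn_primitive {U : Set ℝ} (hU : IsOpen U) {f : ℝ → ℝ → ℝ}
    (hf : ContDiffOn ℝ 1 (fun p : ℝ × ℝ => f p.1 p.2) (univ ×ˢ U)) :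
    ContDiffOn ℝ 1 (fun p : ℝ × ℝ => ∫ s in (0 : ℝ)..p.1, f s p.2) (univ ×ˢ U) := by
  have h1 : ContDiffOn ℝ 1 (fun p : ℝ × ℝ => ∫ s in (0 : ℝ)..1, f (p.1 * s) p.2) (univ ×ˢ U) := by
    refine contDiffOn_intervalIntegral_param (E := ℝ × ℝ) (h := fun s p => f (p.1 * s) p.2)
      (isOpen_univ.prod hU) ?_ 0 1
    refine hf.comp (f := fun q : ℝ × ℝ × ℝ => (q.2.1 * q.1, q.2.2)) ?_ ?_
    · exact ContDiff.contDiffOn (by fun_prop)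
    · exact fun q hq => ⟨mem_univ _, hq.2.2⟩
  refine (contDiffOn_fst.mul h1).congr fun p _ => ?_
  have := intervalIntegral.smul_integral_comp_mul_left (a := 0) (b := 1) (fun s => f s p.2) p.1
  simpa using this.symm

theorem hasDerivAt_primitive {f : ℝ → ℝ} (hf : Continuous f) (θ : ℝ) :
    HasDerivAt (fun θ => ∫ s in (0 : ℝ)..θ, f s) (f θ) θ :=
  intervalIntegral.integral_hasDerivAt_right (hf.intervalIntegrable _ _)
    (hf.stronglyMeasurableAtFilter _ _) hf.continuousAt

theorem continuous_phase_slice {F : Type*} [TopologicalSpace F] {U : Set ℝ} {f : ℝ → ℝ → F}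
    (hf : ContinuousOn (fun p : ℝ × ℝ => f p.1 p.2) (univ ×ˢ U)) {I : ℝ} (hI : I ∈ U) :
    Continuous (fun θ => f θ I) :=
  hf.comp_continuous (f := fun s : ℝ => (s, I)) (by fun_prop) (fun _ => ⟨mem_univ _, hI⟩)

theorem contDiffOn_amp_slice {F : Type*} [NormedAddCommGroup F] [NormedSpace ℝ F] {n : WithTop ℕ∞}
    {U : Set ℝ} {f : ℝ → ℝ → F}
    (hf : ContDiffOn ℝ n (fun p : ℝ × ℝ => f p.1 p.2) (univ ×ˢ U)) (θ : ℝ) :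
    ContDiffOn ℝ n (fun I => f θ I) U :=
  hf.comp (f := fun s : ℝ => (θ, s)) (ContDiff.contDiffOn (by fun_prop))
    (fun _ h => ⟨mem_univ _, h⟩)

theorem contDiffOn_comp_snd {F : Type*} [NormedAddCommGroup F] [NormedSpace ℝ F] {n : WithTop ℕ∞}
    {U : Set ℝ} {f : ℝ → F} (hf : ContDiffOn ℝ n f U) :
    ContDiffOn ℝ n (fun p : ℝ × ℝ => f p.2) (univ ×ˢ U) :=
  hf.comp contDiffOn_snd (fun _ h => h.2)

/-- A continuous function that is periodic in the phase is bounded over compact amplitude ranges. -/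
theorem exists_bound_of_periodic {F : Type*} [NormedAddCommGroup F] {U : Set ℝ} {f : ℝ → ℝ → F}
    (hf : ContinuousOn (fun p : ℝ × ℝ => f p.1 p.2) (univ ×ˢ U))
    (hp : ∀ I ∈ U, Function.Periodic (fun θ => f θ I) (2 * π)) {a b : ℝ} (hab : Icc a b ⊆ U) :
    ∃ M, 0 ≤ M ∧ ∀ θ, ∀ I ∈ Icc a b, ‖f θ I‖ ≤ M := by
  obtain ⟨M, hM⟩ := ((isCompact_Icc (a := (0 : ℝ)) (b := 2 * π)).prod
    (isCompact_Icc (a := a) (b := b))).exists_bound_of_continuousOn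
      (hf.mono (prod_mono (subset_univ _) hab))
  refine ⟨max M 0, le_max_right _ _, fun θ I hI => ?_⟩
  obtain ⟨y, hy, hfy⟩ := (hp I (hab hI)).exists_mem_Ico₀ (by positivity) θ
  have := hM (y, I) ⟨Ico_subset_Icc_self hy, hI⟩
  simp only at hfy this
  rw [hfy]
  exact this.trans (le_max_left _ _)

theorem exists_fderiv_bound_of_periodic {U : Set ℝ} (hU : IsOpen U) {f : ℝ → ℝ → ℝ}
    (hf : ContDiffOn ℝ 1 (fun p : ℝ × ℝ => f p.1 p.2) (univ ×ˢ U))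
    (hp : ∀ I ∈ U, Function.Periodic (fun θ => f θ I) (2 * π)) {a b : ℝ} (hab : Icc a b ⊆ U) :
    ∃ M, 0 ≤ M ∧ ∀ θ, ∀ I ∈ Icc a b, ‖fderiv ℝ (fun p : ℝ × ℝ => f p.1 p.2) (θ, I)‖ ≤ M := by
  have hV : IsOpen ((univ : Set ℝ) ×ˢ U) := isOpen_univ.prod hU
  refine exists_bound_of_periodic (U := U)
    (f := fun θ I => fderiv ℝ (fun p : ℝ × ℝ => f p.1 p.2) (θ, I))
    (hf.continuousOn_fderiv_of_isOpen hV le_rfl) (fun I hI θ => ?_) hab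
  have h1 := fderiv_comp_add_right (𝕜 := ℝ) (f := fun p : ℝ × ℝ => f p.1 p.2) (x := (θ, I))
    (2 * π, 0)
  simp only [Prod.mk_add_mk, add_zero] at h1
  simp only
  rw [← h1]
  -- Periodicity is known only for amplitudes in `U`, so the function and its translate are compared
  -- on a neighbourhood.
  apply Filter.EventuallyEq.fderiv_eq
  filter_upwards [hV.mem_nhds ⟨mem_univ θ, hI⟩] with p hpp
  have := hp p.2 hpp.2 p.1
  simpa using this

theorem lipschitz_of_fderiv_bound {U : Set ℝ} (hU : IsOpen U) {f : ℝ → ℝ → ℝ}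
    (hf : ContDiffOn ℝ 1 (fun p : ℝ × ℝ => f p.1 p.2) (univ ×ˢ U)) {a b M : ℝ} (hab : Icc a b ⊆ U)
    (hM : ∀ θ, ∀ I ∈ Icc a b, ‖fderiv ℝ (fun p : ℝ × ℝ => f p.1 p.2) (θ, I)‖ ≤ M) {p q : ℝ × ℝ}
    (hp : p ∈ (univ : Set ℝ) ×ˢ Icc a b) (hq : q ∈ (univ : Set ℝ) ×ˢ Icc a b) :
    |f q.1 q.2 - f p.1 p.2| ≤ M * ‖q - p‖ :=
  (convex_univ.prod (convex_Icc a b)).norm_image_sub_le_of_norm_fderiv_le (𝕜 := ℝ)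
    (f := fun p : ℝ × ℝ => f p.1 p.2)
    (fun _ hx => (hf.contDiffAt ((isOpen_univ.prod hU).mem_nhds
      ⟨mem_univ _, hab hx.2⟩)).differentiableAt one_ne_zero)
    (fun x hx => hM x.1 x.2 hx.2) hp hq

/-- A small Lipschitz perturbation of the identity is injective. -/
theorem injOn_near_identity {S : Set (ℝ × ℝ)} {v w : ℝ × ℝ → ℝ} {M r : ℝ} (hr : |r| * M < 1)
    (hv : ∀ p ∈ S, ∀ q ∈ S, |v q - v p| ≤ M * ‖q - p‖)
    (hw : ∀ p ∈ S, ∀ q ∈ S, |w q - w p| ≤ M * ‖q - p‖) :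
    InjOn (fun p : ℝ × ℝ => (p.1 - r * v p, p.2 - r * w p)) S := by
  intro p hp q hq hpq
  obtain ⟨h1, h2⟩ := Prod.mk.inj hpq
  have h3 : ‖q - p‖ ≤ |r| * (M * ‖q - p‖) := by
    rw [norm_prod_le_iff]
    constructor
    · rw [Prod.fst_sub, show q.1 - p.1 = r * (v q - v p) by linarith, Real.norm_eq_abs, abs_mul]
      exact mul_le_mul_of_nonneg_left (hv p hp q hq) (abs_nonneg r)
    · rw [Prod.snd_sub, show q.2 - p.2 = r * (w q - w p) by linarith, Real.norm_eq_abs, abs_mul]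
      exact mul_le_mul_of_nonneg_left (hw p hp q hq) (abs_nonneg r)
  have h4 : ‖q - p‖ = 0 := by
    nlinarith [norm_nonneg (q - p)]
  exact (sub_eq_zero.mp (norm_eq_zero.mp h4)).symm

/-- A closed thickening of `K` still lies in `U` and is compact, so a single `ε` and a single
derivative bound serve every centre. The membership `x + h ∈ U` later keeps the shifted amplitude
inside `𝓘`. -/
theorem exists_uniform_lipschitz {U K : Set ℝ} (hU : IsOpen U) (hK : IsCompact K) (hKU : K ⊆ U)
    {f : ℝ → ℝ} (hf : ContDiffOn ℝ 1 f U) :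
    ∃ M ε, 0 ≤ M ∧ 0 < ε ∧ ∀ x ∈ K, ∀ h, |h| ≤ ε → x + h ∈ U ∧ |f (x + h) - f x| ≤ M * |h| := by
  obtain ⟨ε, hε, hsub⟩ := hK.exists_cthickening_subset_open hU hKU
  obtain ⟨M, hM⟩ := hK.cthickening.exists_bound_of_continuousOn
    ((hf.continuousOn_deriv_of_isOpen hU le_rfl).mono hsub)
  have hb : ∀ x ∈ K, Metric.closedBall x ε ⊆ Metric.cthickening ε K := fun x hx =>
    Metric.closedBall_subset_cthickening hx ε
  refine ⟨max M 0, ε, le_max_right _ _, hε, fun x hx h hh => ?_⟩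
  have h1 : x + h ∈ Metric.closedBall x ε := by simpa using hh
  refine ⟨hsub (hb x hx h1), ?_⟩
  have := (convex_closedBall x ε).norm_image_sub_le_of_norm_deriv_le (f := f) (C := max M 0)
    (fun y hy => ((hf.contDiffAt (hU.mem_nhds (hsub (hb x hx hy)))).differentiableAt
      one_ne_zero)) (fun y hy => (hM y (hb x hx hy)).trans (le_max_left _ _))
    (Metric.mem_closedBall_self hε.le) h1
  simpa using this

/-- The function `y ↦ f y - f'(x) y` has derivative at most `M |h|` on the ball of radius `|h|`; the
mean value inequality contributes the second factor `|h|`. -/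
theorem exists_uniform_taylor {U K : Set ℝ} (hU : IsOpen U) (hK : IsCompact K) (hKU : K ⊆ U)
    {f : ℝ → ℝ} (hf : ContDiffOn ℝ 2 f U) :
    ∃ M ε, 0 ≤ M ∧ 0 < ε ∧ ∀ x ∈ K, ∀ h, |h| ≤ ε → x + h ∈ U ∧
      |f (x + h) - f x - deriv f x * h| ≤ M * h ^ 2 := by
  obtain ⟨M, ε, hM, hε, H⟩ := exists_uniform_lipschitz hU hK hKU
    (hf.deriv_of_isOpen (m := 1) hU (by norm_num))
  refine ⟨M, ε, hM, hε, fun x hx h hh => ⟨(H x hx h hh).1, ?_⟩⟩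
  have hmem : ∀ y ∈ Metric.closedBall x |h|, |y - x| ≤ ε := fun y hy =>
    (by simpa [Real.dist_eq] using hy : |y - x| ≤ |h|).trans hh
  have hd : ∀ y ∈ Metric.closedBall x |h|,
      HasDerivAt (fun y => f y - deriv f x * y) (deriv f y - deriv f x) y := by
    intro y hy
    have h2 : y ∈ U := by simpa using (H x hx (y - x) (hmem y hy)).1
    have h3 := ((hf.contDiffAt (hU.mem_nhds h2)).differentiableAt two_ne_zero).hasDerivAt
    simpa using h3.fun_sub ((hasDerivAt_id' y).const_mul (deriv f x))
  have := (convex_closedBall x |h|).norm_image_sub_le_of_norm_hasDerivWithin_le (C := M * |h|)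
    (fun y hy => (hd y hy).hasDerivWithinAt) (fun y hy => by
      have h4 := (H x hx (y - x) (hmem y hy)).2
      rw [add_sub_cancel] at h4
      refine h4.trans (mul_le_mul_of_nonneg_left ?_ hM)
      simpa [Real.dist_eq] using hy)
    (Metric.mem_closedBall_self (abs_nonneg h)) (y := x + h) (by simp)
  rw [add_sub_cancel_left, Real.norm_eq_abs, Real.norm_eq_abs, mul_assoc, abs_mul_abs_self,
    ← pow_two] at this
  convert this using 2
  ring

/-! ### Phase averages, the homological equation and periodic linear equations. -/

theorem phaseAvg_sub {f g : ℝ → ℝ} (hf : Continuous f) (hg : Continuous g) :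
    phaseAvg (fun θ => f θ - g θ) = phaseAvg f - phaseAvg g := by
  simp only [phaseAvg]
  rw [intervalIntegral.integral_sub (hf.intervalIntegrable _ _) (hg.intervalIntegrable _ _)]
  ring

theorem phaseAvg_const (c : ℝ) : phaseAvg (fun _ => c) = c := by
  simp only [phaseAvg, intervalIntegral.integral_const]
  have := Real.pi_pos
  simp only [smul_eq_mul]
  field_simp
  ring

/-- This turns the `L²` normalizations of the adjoint modes into pointwise identities. -/
theorem eq_const_of_phaseAvg {f : ℝ → ℝ} {c : ℝ} (hf : ∀ θ, HasDerivAt f 0 θ)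
    (hc : phaseAvg f = c) (θ : ℝ) : f θ = c := by
  have h1 : f = fun _ => f θ := funext fun x => is_const_of_deriv_eq_zero
    (fun θ => (hf θ).differentiableAt) (fun θ => (hf θ).deriv) x θ
  rw [h1, phaseAvg_const] at hc
  exact hc

theorem phaseAvg_const_mul (c : ℝ) (f : ℝ → ℝ) : phaseAvg (fun θ => c * f θ) = c * phaseAvg f := by
  simp only [phaseAvg, intervalIntegral.integral_const_mul]
  ring

theorem phaseAvg_add {f g : ℝ → ℝ} (hf : Continuous f) (hg : Continuous g) :
    phaseAvg (fun θ => f θ + g θ) = phaseAvg f + phaseAvg g := by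
  simp only [phaseAvg]
  rw [intervalIntegral.integral_add (hf.intervalIntegrable _ _) (hg.intervalIntegrable _ _)]
  ring

theorem contDiffOn_phaseAvg {U : Set ℝ} (hU : IsOpen U) {f : ℝ → ℝ → ℝ}
    (hf : ContDiffOn ℝ 1 (fun p : ℝ × ℝ => f p.1 p.2) (univ ×ˢ U)) :
    ContDiffOn ℝ 1 (fun I => phaseAvg fun θ => f θ I) U :=
  contDiffOn_const.mul (contDiffOn_amp_slice
    (f := fun θ I => ∫ s in (0 : ℝ)..θ, f s I) (contDiffOn_primitive hU hf) (2 * π))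

/-- The homological equation `Ω ∂_θ v = f` for forcing of zero phase average. -/
theorem exists_corrector {U : Set ℝ} (hU : IsOpen U) {Ω : ℝ → ℝ} (hΩ : ContDiffOn ℝ 1 Ω U)
    (hΩ0 : ∀ I ∈ U, 0 < Ω I) {f : ℝ → ℝ → ℝ}
    (hf : ContDiffOn ℝ 1 (fun p : ℝ × ℝ => f p.1 p.2) (univ ×ˢ U))
    (hp : ∀ I ∈ U, Function.Periodic (fun θ => f θ I) (2 * π))
    (h0 : ∀ I ∈ U, phaseAvg (fun θ => f θ I) = 0) :
    ∃ v, IsCorrector U v ∧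
      ∀ I ∈ U, ∀ θ, HasDerivAt (fun θ => v θ I) ((Ω I)⁻¹ * f θ I) θ := by
  set P : ℝ → ℝ → ℝ := fun θ I => ∫ s in (0 : ℝ)..θ, f s I with hP
  have hPc : ContDiffOn ℝ 1 (fun p : ℝ × ℝ => P p.1 p.2) (univ ×ˢ U) := contDiffOn_primitive hU hf
  have hfc : ∀ I ∈ U, Continuous (fun θ => f θ I) := fun I hI =>
    continuous_phase_slice hf.continuousOn hI
  have hPcont : ∀ I ∈ U, Continuous (fun θ => P θ I) := fun I hI =>
    continuous_phase_slice hPc.continuousOn hI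
  -- Subtracting its own mean from the primitive fixes the free constant; the primitive is periodic
  -- because `f` has zero mean.
  refine ⟨fun θ I => (Ω I)⁻¹ * (P θ I - phaseAvg fun θ => P θ I), ⟨?_, ?_, ?_⟩, ?_⟩
  · exact (contDiffOn_comp_snd (hΩ.inv fun I hI => (hΩ0 I hI).ne')).mul
      (hPc.sub (contDiffOn_comp_snd (contDiffOn_phaseAvg hU hPc)))
  · intro I hI θ
    have h1 : P (θ + 2 * π) I = P θ I := by
      have h2 := (hp I hI).intervalIntegral_add_eq θ 0
      have h3 : ∫ s in (0 : ℝ)..(0 + 2 * π), f s I = 0 := by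
        have := h0 I hI
        simp only [phaseAvg] at this
        rw [zero_add]
        exact (mul_eq_zero.mp this).resolve_left (by positivity)
      have h4 := intervalIntegral.integral_add_adjacent_intervals (a := 0) (b := θ)
        (c := θ + 2 * π) ((hfc I hI).intervalIntegrable (μ := MeasureTheory.volume) _ _)
        ((hfc I hI).intervalIntegrable _ _)
      simp only [hP]
      rw [← h4, h2, h3, add_zero]
    simp only [h1]
  · intro I hI
    rw [phaseAvg_const_mul, phaseAvg_sub (hPcont I hI) continuous_const, phaseAvg_const, sub_self,
      mul_zero]
  · intro I hI θ
    exact ((hasDerivAt_primitive (hfc I hI) θ).sub_const _).const_mul _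

/-- Since `k > 0`, the period map of the linear equation is a contraction and its fixed point is
explicit; the variation of constants formula then shows `C¹` dependence on the amplitude. -/
theorem exists_periodic_linear_solution {U : Set ℝ} (hU : IsOpen U) {k : ℝ → ℝ}
    (hk : ContDiffOn ℝ 1 k U) (hk0 : ∀ I ∈ U, 0 < k I) {g : ℝ → ℝ → ℝ}
    (hg : ContDiffOn ℝ 1 (fun p : ℝ × ℝ => g p.1 p.2) (univ ×ˢ U))
    (hp : ∀ I ∈ U, Function.Periodic (fun θ => g θ I) (2 * π)) :
    ∃ e : ℝ → ℝ → ℝ, ContDiffOn ℝ 1 (fun p : ℝ × ℝ => e p.1 p.2) (univ ×ˢ U) ∧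
      (∀ I ∈ U, Function.Periodic (fun θ => e θ I) (2 * π)) ∧
      ∀ I ∈ U, ∀ θ, HasDerivAt (fun θ => e θ I) (-(k I) * e θ I + g θ I) θ := by
  set Q : ℝ → ℝ → ℝ := fun θ I => ∫ s in (0 : ℝ)..θ, exp (k I * s) * g s I with hQ
  have hk2 := contDiffOn_comp_snd hk
  have hfc : ContDiffOn ℝ 1 (fun p : ℝ × ℝ => exp (k p.2 * p.1) * g p.1 p.2) (univ ×ˢ U) :=
    (hk2.mul contDiffOn_fst).exp.mul hg
  have hQc : ContDiffOn ℝ 1 (fun p : ℝ × ℝ => Q p.1 p.2) (univ ×ˢ U) :=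
    contDiffOn_primitive (f := fun θ I => exp (k I * θ) * g θ I) hU hfc
  have hpos : ∀ I ∈ U, exp (k I * (2 * π)) - 1 ≠ 0 := fun I hI => by
    have : 1 < exp (k I * (2 * π)) :=
      one_lt_exp_iff.mpr (mul_pos (hk0 I hI) (by positivity))
    linarith
  -- The initial value for which the solution returns to itself after `2 π`.
  set c : ℝ → ℝ := fun I => Q (2 * π) I / (exp (k I * (2 * π)) - 1) with hc
  have hcc : ContDiffOn ℝ 1 c U :=
    (contDiffOn_amp_slice hQc (2 * π)).div ((hk.mul contDiffOn_const).exp.sub contDiffOn_const) hpos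
  set e : ℝ → ℝ → ℝ := fun θ I => exp (-(k I * θ)) * (c I + Q θ I) with he
  have hd : ∀ I ∈ U, ∀ θ, HasDerivAt (fun θ => e θ I) (-(k I) * e θ I + g θ I) θ := by
    intro I hI θ
    have h1 : HasDerivAt (fun θ => Q θ I) (exp (k I * θ) * g θ I) θ :=
      hasDerivAt_primitive (f := fun s => exp (k I * s) * g s I)
        (continuous_phase_slice (f := fun θ I => exp (k I * θ) * g θ I) hfc.continuousOn hI) θ
    have h2 : HasDerivAt (fun θ => exp (-(k I * θ))) (exp (-(k I * θ)) * -(k I * 1)) θ :=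
      ((hasDerivAt_id' θ).const_mul (k I)).fun_neg.exp
    refine (h2.fun_mul (h1.const_add (c I))).congr_deriv ?_
    have h3 : exp (-(k I * θ)) * exp (k I * θ) = 1 := by rw [← exp_add]; simp
    simp only [he]
    linear_combination (g θ I) * h3
  refine ⟨e, ((hk2.mul contDiffOn_fst).neg.exp).mul ((contDiffOn_comp_snd hcc).add hQc), ?_, hd⟩
  intro I hI
  have h0 : e (2 * π) I = e 0 I := by
    have h3 : exp (-(k I * (2 * π))) * exp (k I * (2 * π)) = 1 := by rw [← exp_add]; simp
    have h4 : c I * (exp (k I * (2 * π)) - 1) = Q (2 * π) I := div_mul_cancel₀ _ (hpos I hI)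
    have h5 : Q 0 I = 0 := by simp [hQ]
    simp only [he, h5, ← h4]
    simp only [mul_zero, neg_zero, exp_zero, add_zero, one_mul]
    linear_combination (c I) * h3
  -- The difference between the solution and its translate solves the homogeneous equation and
  -- vanishes at `0`; the integrating factor shows it vanishes everywhere.
  have hH : ∀ θ, HasDerivAt (fun θ => exp (k I * θ) * (e (θ + 2 * π) I - e θ I)) 0 θ := by
    intro θ
    have h1 : HasDerivAt (fun θ => exp (k I * θ)) (exp (k I * θ) * (k I * 1)) θ :=
      ((hasDerivAt_id' θ).const_mul (k I)).exp
    have h2 := (HasDerivAt.comp_add_const θ (2 * π) (hd I hI _)).fun_sub (hd I hI θ)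
    refine (h1.fun_mul h2).congr_deriv ?_
    have := hp I hI θ
    simp only at this
    rw [this]
    ring
  intro θ
  have h6 := is_const_of_deriv_eq_zero (fun θ => (hH θ).differentiableAt)
    (fun θ => (hH θ).deriv) θ 0
  simp only [zero_add, h0, sub_self, mul_zero] at h6
  exact sub_eq_zero.mp ((mul_eq_zero.mp h6).resolve_left (exp_pos _).ne')

/-! ### Partial derivatives and the chain rule along curves. -/

section Slices

variable {F : Type*} [NormedAddCommGroup F] [NormedSpace ℝ F] {f : ℝ × ℝ → F} {f' : ℝ × ℝ →L[ℝ] F}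
  {θ I : ℝ}

theorem HasFDerivAt.hasDerivAt_phase (h : HasFDerivAt f f' (θ, I)) :
    HasDerivAt (fun θ => f (θ, I)) (f' (1, 0)) θ :=
  HasFDerivAt.comp_hasDerivAt (f := fun θ => (θ, I)) θ h
    ((hasDerivAt_id' θ).prodMk (hasDerivAt_const θ I))

theorem HasFDerivAt.hasDerivAt_amp (h : HasFDerivAt f f' (θ, I)) :
    HasDerivAt (fun I => f (θ, I)) (f' (0, 1)) I :=
  HasFDerivAt.comp_hasDerivAt (f := fun I => (θ, I)) I h
    ((hasDerivAt_const I θ).prodMk (hasDerivAt_id' I))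

theorem HasFDerivAt.hasDerivAt_curve {φ A : ℝ → ℝ} {t : ℝ} (h : HasFDerivAt f f' (φ t, A t))
    (hφ : DifferentiableAt ℝ φ t) (hA : DifferentiableAt ℝ A t) :
    HasDerivAt (fun t => f (φ t, A t)) (deriv φ t • f' (1, 0) + deriv A t • f' (0, 1)) t := by
  refine (HasFDerivAt.comp_hasDerivAt (f := fun t => (φ t, A t)) t h
    (hφ.hasDerivAt.prodMk hA.hasDerivAt)).congr_deriv ?_
  rw [← map_smul, ← map_smul, ← map_add]
  simp

end Slices

/-! ### Regularity of the cycle family and its variational equations. -/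

section Goodwin

variable {m : KeenModel} {𝓘 : Set ℝ} {X : ℝ → ℝ → Fin 2 → ℝ} {Ω : ℝ → ℝ}

/-- Being `C²` at a point is an open condition, so the set of such points is a domain on which `κ`
can be expanded to second order, although `κ` is only `C¹` globally. -/
theorem KeenModel.isOpen_smooth (m : KeenModel) : IsOpen {x | ContDiffAt ℝ 2 m.κ x} :=
  isOpen_iff_mem_nhds.mpr fun _ hx => ContDiffAt.eventually hx (by simp)

theorem KeenModel.contDiffOn_smooth (m : KeenModel) :
    ContDiffOn ℝ 2 m.κ {x | ContDiffAt ℝ 2 m.κ x} := fun _ hx => ContDiffAt.contDiffWithinAt hx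

theorem KeenModel.contDiffOn_deriv (m : KeenModel) :
    ContDiffOn ℝ 1 (deriv m.κ) {x | ContDiffAt ℝ 2 m.κ x} :=
  m.contDiffOn_smooth.deriv_of_isOpen m.isOpen_smooth (by norm_num)

theorem differentiableAt_F₀ (m : KeenModel) {x : Fin 2 → ℝ} (hx : x 1 ∈ Ioo (0 : ℝ) 1) :
    DifferentiableAt ℝ (F₀ m) x := by
  have hΦ : DifferentiableAt ℝ m.Φ (x 1) :=
    (m.Φ_contDiff.contDiffAt (isOpen_Ioo.mem_nhds hx)).differentiableAt one_ne_zero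
  have hκ : DifferentiableAt ℝ m.κ (1 - x 0) := m.κ_contDiff.contDiffAt.differentiableAt one_ne_zero
  have h0 : DifferentiableAt ℝ (fun x : Fin 2 → ℝ => x 0) x := differentiableAt_apply 0 x
  have h1 : DifferentiableAt ℝ (fun x : Fin 2 → ℝ => x 1) x := differentiableAt_apply 1 x
  have hΦ' : DifferentiableAt ℝ (fun x : Fin 2 → ℝ => m.Φ (x 1)) x :=
    DifferentiableAt.comp x (g := m.Φ) hΦ h1
  have hκ' : DifferentiableAt ℝ (fun x : Fin 2 → ℝ => m.κ (1 - x 0)) x :=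
    DifferentiableAt.comp x (g := m.κ) (f := fun x : Fin 2 → ℝ => 1 - x 0) hκ (h0.const_sub 1)
  rw [differentiableAt_pi]
  intro i
  fin_cases i
  · exact h0.mul (hΦ'.sub_const _)
  · exact h1.mul ((((hκ'.mul_const m.ν⁻¹).sub_const _).sub_const _).sub_const _)

theorem J₀_mulVec (m : KeenModel) (x v : Fin 2 → ℝ) : J₀ m x *ᵥ v = fderiv ℝ (F₀ m) x v := by
  rw [J₀, LinearMap.toMatrix'_mulVec]
  rfl

theorem transpose_J₀_mulVec_dotProduct (m : KeenModel) (x z v : Fin 2 → ℝ) :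
    ((J₀ m x)ᵀ *ᵥ z) ⬝ᵥ v = z ⬝ᵥ fderiv ℝ (F₀ m) x v := by
  rw [← J₀_mulVec, mulVec_transpose, dotProduct_mulVec]

namespace IsGoodwinFamily

theorem isOpen_dom (hX : IsGoodwinFamily m 𝓘 X Ω) : IsOpen ((univ : Set ℝ) ×ˢ 𝓘) :=
  isOpen_univ.prod hX.isOpen

theorem contDiffAt (hX : IsGoodwinFamily m 𝓘 X Ω) {I : ℝ} (hI : I ∈ 𝓘) (θ : ℝ) :
    ContDiffAt ℝ 2 (fun p : ℝ × ℝ => X p.1 p.2) (θ, I) :=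
  hX.contDiffOn.contDiffAt (hX.isOpen_dom.mem_nhds ⟨mem_univ _, hI⟩)

theorem hasFDerivAt (hX : IsGoodwinFamily m 𝓘 X Ω) {I : ℝ} (hI : I ∈ 𝓘) (θ : ℝ) :
    HasFDerivAt (fun p : ℝ × ℝ => X p.1 p.2) (fderiv ℝ (fun p : ℝ × ℝ => X p.1 p.2) (θ, I))
      (θ, I) :=
  ((hX.contDiffAt hI θ).differentiableAt two_ne_zero).hasFDerivAt

theorem hasDerivAt_phase_fderiv (hX : IsGoodwinFamily m 𝓘 X Ω) {I : ℝ} (hI : I ∈ 𝓘) (θ : ℝ) :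
    HasDerivAt (fun θ => X θ I) (fderiv ℝ (fun p : ℝ × ℝ => X p.1 p.2) (θ, I) (1, 0)) θ :=
  HasFDerivAt.hasDerivAt_phase (hX.hasFDerivAt hI θ)

theorem hasDerivAt_amp_fderiv (hX : IsGoodwinFamily m 𝓘 X Ω) {I : ℝ} (hI : I ∈ 𝓘) (θ : ℝ) :
    HasDerivAt (fun I => X θ I) (fderiv ℝ (fun p : ℝ × ℝ => X p.1 p.2) (θ, I) (0, 1)) I :=
  HasFDerivAt.hasDerivAt_amp (hX.hasFDerivAt hI θ)

theorem dPhase_eq (hX : IsGoodwinFamily m 𝓘 X Ω) {I : ℝ} (hI : I ∈ 𝓘) (θ : ℝ) :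
    dPhase X θ I = fderiv ℝ (fun p : ℝ × ℝ => X p.1 p.2) (θ, I) (1, 0) :=
  (hX.hasDerivAt_phase_fderiv hI θ).deriv

theorem dAmp_eq (hX : IsGoodwinFamily m 𝓘 X Ω) {I : ℝ} (hI : I ∈ 𝓘) (θ : ℝ) :
    dAmp X θ I = fderiv ℝ (fun p : ℝ × ℝ => X p.1 p.2) (θ, I) (0, 1) :=
  (hX.hasDerivAt_amp_fderiv hI θ).deriv

theorem hasDerivAt_phase (hX : IsGoodwinFamily m 𝓘 X Ω) {I : ℝ} (hI : I ∈ 𝓘) (θ : ℝ) :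
    HasDerivAt (fun θ => X θ I) (dPhase X θ I) θ :=
  hX.dPhase_eq hI θ ▸ hX.hasDerivAt_phase_fderiv hI θ

theorem hasDerivAt_amp (hX : IsGoodwinFamily m 𝓘 X Ω) {I : ℝ} (hI : I ∈ 𝓘) (θ : ℝ) :
    HasDerivAt (fun I => X θ I) (dAmp X θ I) I :=
  hX.dAmp_eq hI θ ▸ hX.hasDerivAt_amp_fderiv hI θ

theorem contDiffOn_fderiv (hX : IsGoodwinFamily m 𝓘 X Ω) :
    ContDiffOn ℝ 1 (fderiv ℝ (fun p : ℝ × ℝ => X p.1 p.2)) (univ ×ˢ 𝓘) :=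
  hX.contDiffOn.fderiv_of_isOpen hX.isOpen_dom (by norm_num)

theorem contDiffOn_dPhase (hX : IsGoodwinFamily m 𝓘 X Ω) :
    ContDiffOn ℝ 1 (fun p : ℝ × ℝ => dPhase X p.1 p.2) (univ ×ˢ 𝓘) :=
  (hX.contDiffOn_fderiv.clm_apply contDiffOn_const).congr fun p hp => hX.dPhase_eq hp.2 p.1

theorem contDiffOn_dAmp (hX : IsGoodwinFamily m 𝓘 X Ω) :
    ContDiffOn ℝ 1 (fun p : ℝ × ℝ => dAmp X p.1 p.2) (univ ×ˢ 𝓘) :=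
  (hX.contDiffOn_fderiv.clm_apply contDiffOn_const).congr fun p hp => hX.dAmp_eq hp.2 p.1

theorem periodic_dPhase (hX : IsGoodwinFamily m 𝓘 X Ω) {I : ℝ} (hI : I ∈ 𝓘) :
    Function.Periodic (fun θ => dPhase X θ I) (2 * π) := by
  intro θ
  have h1 : (fun θ' => X (θ' + 2 * π) I) = fun θ' => X θ' I := funext (hX.periodic I hI)
  simp only [dPhase]
  rw [← deriv_comp_add_const, h1]

theorem periodic_dAmp (hX : IsGoodwinFamily m 𝓘 X Ω) {I : ℝ} (hI : I ∈ 𝓘) :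
    Function.Periodic (fun θ => dAmp X θ I) (2 * π) := by
  intro θ
  simp only [dAmp]
  refine Filter.EventuallyEq.deriv_eq ?_
  filter_upwards [hX.isOpen.mem_nhds hI] with I' hI'
  exact hX.periodic I' hI' θ

theorem hasFDerivAt_fderiv (hX : IsGoodwinFamily m 𝓘 X Ω) {I : ℝ} (hI : I ∈ 𝓘) (θ : ℝ) :
    HasFDerivAt (fderiv ℝ (fun p : ℝ × ℝ => X p.1 p.2))
      (fderiv ℝ (fderiv ℝ (fun p : ℝ × ℝ => X p.1 p.2)) (θ, I)) (θ, I) :=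
  ((hX.contDiffOn_fderiv.contDiffAt (hX.isOpen_dom.mem_nhds ⟨mem_univ _, hI⟩)).differentiableAt
    one_ne_zero).hasFDerivAt

/-- The variational equation satisfied by the phase derivative of the family. -/
theorem exists_hasDerivAt_dPhase (hX : IsGoodwinFamily m 𝓘 X Ω) {I : ℝ} (hI : I ∈ 𝓘) (θ : ℝ) :
    ∃ v, HasDerivAt (fun θ => dPhase X θ I) v θ ∧
      Ω I • v = fderiv ℝ (F₀ m) (X θ I) (dPhase X θ I) := by
  have h1 : DifferentiableAt ℝ (fun θ => dPhase X θ I) θ :=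
    ((hX.contDiffOn_dPhase.contDiffAt (hX.isOpen_dom.mem_nhds
      (show (θ, I) ∈ _ from ⟨mem_univ _, hI⟩))).differentiableAt one_ne_zero).comp θ
      (f := fun θ => (θ, I)) (by fun_prop)
  refine ⟨_, h1.hasDerivAt, ?_⟩
  have h2 := h1.hasDerivAt.const_smul (Ω I)
  have h3 : HasDerivAt (fun θ => F₀ m (X θ I)) (fderiv ℝ (F₀ m) (X θ I) (dPhase X θ I)) θ :=
    HasFDerivAt.comp_hasDerivAt (f := fun θ => X θ I) θ
      (differentiableAt_F₀ m (hX.employment_mem I hI θ)).hasFDerivAt (hX.hasDerivAt_phase hI θ)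
  refine h2.unique (h3.congr_of_eventuallyEq (Filter.Eventually.of_forall fun θ => ?_))
  exact hX.cycle I hI θ

/-- The variational equation satisfied by the amplitude derivative of the family. -/
theorem exists_hasDerivAt_dAmp (hX : IsGoodwinFamily m 𝓘 X Ω) {I : ℝ} (hI : I ∈ 𝓘) (θ : ℝ) :
    ∃ v, HasDerivAt (fun θ => dAmp X θ I) v θ ∧
      Ω I • v = fderiv ℝ (F₀ m) (X θ I) (dAmp X θ I) - deriv Ω I • dPhase X θ I := by
  set D2 := fderiv ℝ (fderiv ℝ (fun p : ℝ × ℝ => X p.1 p.2)) (θ, I) with hD2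
  -- The phase derivative of `∂_I X` is exchanged for the amplitude derivative of `∂_θ X`, on which
  -- the cycle equation gives information.
  have hsymm : D2 (1, 0) (0, 1) = D2 (0, 1) (1, 0) :=
    (hX.contDiffAt hI θ).isSymmSndFDerivAt (by simp) (1, 0) (0, 1)
  have h1 : HasDerivAt (fun θ => dAmp X θ I) (D2 (1, 0) (0, 1)) θ := by
    have := (HasFDerivAt.hasDerivAt_phase (hX.hasFDerivAt_fderiv hI θ)).clm_apply
        (hasDerivAt_const θ ((0, 1) : ℝ × ℝ))
    simp only [map_zero, add_zero] at this
    refine this.congr_of_eventuallyEq (Filter.Eventually.of_forall fun θ => ?_)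
    exact hX.dAmp_eq hI θ
  have h2 : HasDerivAt (fun I => dPhase X θ I) (D2 (0, 1) (1, 0)) I := by
    have := (HasFDerivAt.hasDerivAt_amp (hX.hasFDerivAt_fderiv hI θ)).clm_apply
        (hasDerivAt_const I ((1, 0) : ℝ × ℝ))
    simp only [map_zero, add_zero] at this
    refine this.congr_of_eventuallyEq ?_
    filter_upwards [hX.isOpen.mem_nhds hI] with I' hI'
    exact hX.dPhase_eq hI' θ
  refine ⟨_, h1, ?_⟩
  have h3 : HasDerivAt (fun I => F₀ m (X θ I)) (fderiv ℝ (F₀ m) (X θ I) (dAmp X θ I)) I :=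
    HasFDerivAt.comp_hasDerivAt (f := fun I => X θ I) I
      (differentiableAt_F₀ m (hX.employment_mem I hI θ)).hasFDerivAt (hX.hasDerivAt_amp hI θ)
  have hΩ : HasDerivAt Ω (deriv Ω I) I :=
    ((hX.contDiffOn_freq.contDiffAt (hX.isOpen.mem_nhds hI)).differentiableAt
      two_ne_zero).hasDerivAt
  -- The product rule for `Ω(I) ∂_θ X` produces the term `Ω' ∂_θ X`, the effect of the period
  -- varying with the amplitude.
  have h4 := (hΩ.fun_smul h2).unique (h3.congr_of_eventuallyEq (by
    filter_upwards [hX.isOpen.mem_nhds hI] with I' hI'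
    exact hX.cycle I' hI' θ))
  rw [← h4, hsymm]
  abel

end IsGoodwinFamily

/-! ### Dual bases in the plane. -/

section PlaneDuals

/-- The first vector of the basis dual to `(v, w)`. -/
def dualFst (v w : Fin 2 → ℝ) : Fin 2 → ℝ := (v 0 * w 1 - v 1 * w 0)⁻¹ • ![w 1, -w 0]

/-- The second vector of the basis dual to `(v, w)`. -/
def dualSnd (v w : Fin 2 → ℝ) : Fin 2 → ℝ := (v 0 * w 1 - v 1 * w 0)⁻¹ • ![-v 1, v 0]

variable {v w : Fin 2 → ℝ}

theorem det_ne_zero_of_linearIndependent (h : LinearIndependent ℝ ![v, w]) :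
    v 0 * w 1 - v 1 * w 0 ≠ 0 := by
  intro hdet
  rw [LinearIndependent.pair_iff] at h
  have h1 := h (w 1) (-v 1) (by
    ext i
    fin_cases i
    · simp only [Fin.zero_eta, Pi.add_apply, Pi.smul_apply, smul_eq_mul, Pi.zero_apply]
      linear_combination hdet
    · simp only [Fin.mk_one, Pi.add_apply, Pi.smul_apply, smul_eq_mul, Pi.zero_apply]
      ring)
  have h2 := h (w 0) (-v 0) (by
    ext i
    fin_cases i
    · simp only [Fin.zero_eta, Pi.add_apply, Pi.smul_apply, smul_eq_mul, Pi.zero_apply]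
      ring
    · simp only [Fin.mk_one, Pi.add_apply, Pi.smul_apply, smul_eq_mul, Pi.zero_apply]
      linear_combination -hdet)
  have h3 := h 1 0 (by
    ext i
    fin_cases i
    · simpa using h2.2
    · simpa using h1.2)
  exact one_ne_zero h3.1

theorem dualFst_dotProduct_fst (h : v 0 * w 1 - v 1 * w 0 ≠ 0) : dualFst v w ⬝ᵥ v = 1 := by
  simp only [dualFst, vec2_dotProduct, Pi.smul_apply, smul_eq_mul, cons_val_zero, cons_val_one]
  field_simp
  ring

theorem dualFst_dotProduct_snd : dualFst v w ⬝ᵥ w = 0 := by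
  simp only [dualFst, vec2_dotProduct, Pi.smul_apply, smul_eq_mul, cons_val_zero, cons_val_one]
  ring

theorem dualSnd_dotProduct_fst : dualSnd v w ⬝ᵥ v = 0 := by
  simp only [dualSnd, vec2_dotProduct, Pi.smul_apply, smul_eq_mul, cons_val_zero, cons_val_one]
  ring

theorem dualSnd_dotProduct_snd (h : v 0 * w 1 - v 1 * w 0 ≠ 0) : dualSnd v w ⬝ᵥ w = 1 := by
  simp only [dualSnd, vec2_dotProduct, Pi.smul_apply, smul_eq_mul, cons_val_zero, cons_val_one]
  field_simp
  ring

theorem eq_of_dotProduct_eq (h : v 0 * w 1 - v 1 * w 0 ≠ 0) {y z : Fin 2 → ℝ}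
    (hv : y ⬝ᵥ v = z ⬝ᵥ v) (hw : y ⬝ᵥ w = z ⬝ᵥ w) : y = z := by
  rw [vec2_dotProduct, vec2_dotProduct] at hv hw
  ext i
  refine mul_right_cancel₀ h ?_
  fin_cases i
  · simp only [Fin.zero_eta]
    linear_combination w 1 * hv - v 1 * hw
  · simp only [Fin.mk_one]
    linear_combination v 0 * hw - w 0 * hv

theorem abs_dotProduct_le_two (y z : Fin 2 → ℝ) : |y ⬝ᵥ z| ≤ 2 * ‖y‖ * ‖z‖ := by
  rw [vec2_dotProduct]
  have h : ∀ i, |y i * z i| ≤ ‖y‖ * ‖z‖ := fun i => by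
    rw [abs_mul]
    exact mul_le_mul (norm_le_pi_norm y i) (norm_le_pi_norm z i) (abs_nonneg _) (norm_nonneg _)
  linarith [abs_add_le (y 0 * z 0) (y 1 * z 1), h 0, h 1]

theorem HasDerivAt.dotProduct_two {u v : ℝ → Fin 2 → ℝ} {u' v' : Fin 2 → ℝ} {t : ℝ}
    (hu : HasDerivAt u u' t) (hv : HasDerivAt v v' t) :
    HasDerivAt (fun t => u t ⬝ᵥ v t) (u' ⬝ᵥ v t + u t ⬝ᵥ v') t := by
  rw [hasDerivAt_pi] at hu hv
  simp only [vec2_dotProduct]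
  refine (((hu 0).fun_mul (hv 0)).fun_add ((hu 1).fun_mul (hv 1))).congr_deriv ?_
  ring

theorem ContDiffOn.dotProduct_two {E : Type*} [NormedAddCommGroup E] [NormedSpace ℝ E]
    {n : WithTop ℕ∞} {s : Set E} {u v : E → Fin 2 → ℝ} (hu : ContDiffOn ℝ n u s)
    (hv : ContDiffOn ℝ n v s) : ContDiffOn ℝ n (fun x => u x ⬝ᵥ v x) s := by
  rw [contDiffOn_pi] at hu hv
  simp only [vec2_dotProduct]
  exact ((hu 0).mul (hv 0)).add ((hu 1).mul (hv 1))

theorem contDiffOn_vec2 {E : Type*} [NormedAddCommGroup E] [NormedSpace ℝ E]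
    {n : WithTop ℕ∞} {s : Set E} {f g : E → ℝ} (hf : ContDiffOn ℝ n f s)
    (hg : ContDiffOn ℝ n g s) : ContDiffOn ℝ n (fun x => ![f x, g x]) s := by
  rw [contDiffOn_pi]
  intro i
  fin_cases i
  · exact hf
  · exact hg

end PlaneDuals

/-! ### The adjoint modes as the dual basis. -/

variable {I : ℝ}

namespace IsGoodwinFamily

theorem det_ne_zero (hX : IsGoodwinFamily m 𝓘 X Ω) (hI : I ∈ 𝓘) (θ : ℝ) :
    dPhase X θ I 0 * dAmp X θ I 1 - dPhase X θ I 1 * dAmp X θ I 0 ≠ 0 :=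
  det_ne_zero_of_linearIndependent (hX.regular I hI θ)

/-- The Jacobian in the variational equation passes to `Z` as a transpose, so the pairing varies
only through the residual of the adjoint equation. -/
theorem exists_hasDerivAt_dotProduct_dPhase (hX : IsGoodwinFamily m 𝓘 X Ω) (hI : I ∈ 𝓘)
    {Z : ℝ → Fin 2 → ℝ} (hZ : Differentiable ℝ Z) (θ : ℝ) :
    ∃ p, HasDerivAt (fun θ => Z θ ⬝ᵥ dPhase X θ I) p θ ∧
      Ω I * p = (Ω I • deriv Z θ + (J₀ m (X θ I))ᵀ *ᵥ Z θ) ⬝ᵥ dPhase X θ I := by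
  obtain ⟨v, hv, hv'⟩ := hX.exists_hasDerivAt_dPhase hI θ
  refine ⟨_, (hZ θ).hasDerivAt.dotProduct_two hv, ?_⟩
  rw [add_dotProduct, transpose_J₀_mulVec_dotProduct, ← hv', dotProduct_smul, smul_dotProduct,
    mul_add, smul_eq_mul, smul_eq_mul]

theorem exists_hasDerivAt_dotProduct_dAmp (hX : IsGoodwinFamily m 𝓘 X Ω) (hI : I ∈ 𝓘)
    {Z : ℝ → Fin 2 → ℝ} (hZ : Differentiable ℝ Z) (θ : ℝ) :
    ∃ p, HasDerivAt (fun θ => Z θ ⬝ᵥ dAmp X θ I) p θ ∧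
      Ω I * p = (Ω I • deriv Z θ + (J₀ m (X θ I))ᵀ *ᵥ Z θ) ⬝ᵥ dAmp X θ I
        - deriv Ω I * (Z θ ⬝ᵥ dPhase X θ I) := by
  obtain ⟨v, hv, hv'⟩ := hX.exists_hasDerivAt_dAmp hI θ
  refine ⟨_, (hZ θ).hasDerivAt.dotProduct_two hv, ?_⟩
  have h := congrArg (fun x => Z θ ⬝ᵥ x) hv'
  simp only [dotProduct_smul, dotProduct_sub, smul_eq_mul] at h
  rw [add_dotProduct, transpose_J₀_mulVec_dotProduct, smul_dotProduct, smul_eq_mul]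
  linear_combination h

theorem contDiffOn_inv_det (hX : IsGoodwinFamily m 𝓘 X Ω) :
    ContDiffOn ℝ 1 (fun p : ℝ × ℝ => (dPhase X p.1 p.2 0 * dAmp X p.1 p.2 1
      - dPhase X p.1 p.2 1 * dAmp X p.1 p.2 0)⁻¹) (univ ×ˢ 𝓘) := by
  have h1 := contDiffOn_pi.mp hX.contDiffOn_dPhase
  have h2 := contDiffOn_pi.mp hX.contDiffOn_dAmp
  exact (((h1 0).mul (h2 1)).sub ((h1 1).mul (h2 0))).inv fun p hp => hX.det_ne_zero hp.2 p.1

theorem contDiffOn_dualFst (hX : IsGoodwinFamily m 𝓘 X Ω) :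
    ContDiffOn ℝ 1 (fun p : ℝ × ℝ => dualFst (dPhase X p.1 p.2) (dAmp X p.1 p.2)) (univ ×ˢ 𝓘) :=
  have h2 := contDiffOn_pi.mp hX.contDiffOn_dAmp
  hX.contDiffOn_inv_det.smul (contDiffOn_vec2 (h2 1) (h2 0).neg)

theorem contDiffOn_dualSnd (hX : IsGoodwinFamily m 𝓘 X Ω) :
    ContDiffOn ℝ 1 (fun p : ℝ × ℝ => dualSnd (dPhase X p.1 p.2) (dAmp X p.1 p.2)) (univ ×ˢ 𝓘) :=
  have h1 := contDiffOn_pi.mp hX.contDiffOn_dPhase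
  hX.contDiffOn_inv_det.smul (contDiffOn_vec2 (h1 1).neg (h1 0))

theorem differentiable_phase_slice (hX : IsGoodwinFamily m 𝓘 X Ω) {F : Type*}
    [NormedAddCommGroup F] [NormedSpace ℝ F] {f : ℝ → ℝ → F}
    (hf : ContDiffOn ℝ 1 (fun p : ℝ × ℝ => f p.1 p.2) (univ ×ˢ 𝓘)) (hI : I ∈ 𝓘) :
    Differentiable ℝ (fun θ => f θ I) := fun θ =>
  (HasFDerivAt.hasDerivAt_phase ((hf.contDiffAt (hX.isOpen_dom.mem_nhds
    (show (θ, I) ∈ _ from ⟨mem_univ _, hI⟩))).differentiableAt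
      one_ne_zero).hasFDerivAt).differentiableAt

/-- Constant pairings have zero derivative, so the adjoint residual is orthogonal to both basis
vectors and vanishes. -/
theorem isAmplitudeMode_dualSnd (hX : IsGoodwinFamily m 𝓘 X Ω) (hI : I ∈ 𝓘) :
    IsAmplitudeMode m X Ω I (fun θ => dualSnd (dPhase X θ I) (dAmp X θ I)) := by
  have hZ := hX.differentiable_phase_slice (f := fun θ I => dualSnd (dPhase X θ I) (dAmp X θ I))
    hX.contDiffOn_dualSnd hI
  have e1 : ∀ θ, dualSnd (dPhase X θ I) (dAmp X θ I) ⬝ᵥ dPhase X θ I = 0 := fun θ =>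
    dualSnd_dotProduct_fst
  have e2 : ∀ θ, dualSnd (dPhase X θ I) (dAmp X θ I) ⬝ᵥ dAmp X θ I = 1 := fun θ =>
    dualSnd_dotProduct_snd (hX.det_ne_zero hI θ)
  refine ⟨hZ, fun θ => ?_, fun θ => ?_, ?_, ?_⟩
  · have h1 := hX.periodic_dPhase hI θ
    have h2 := hX.periodic_dAmp hI θ
    simp only at h1 h2
    simp only [h1, h2]
  · obtain ⟨p, hp, hp'⟩ := hX.exists_hasDerivAt_dotProduct_dPhase hI hZ θ
    obtain ⟨q, hq, hq'⟩ := hX.exists_hasDerivAt_dotProduct_dAmp hI hZ θ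
    simp only [e1] at hp hq'
    simp only [e2] at hq
    have hp0 := hp.unique (hasDerivAt_const θ 0)
    have hq0 := hq.unique (hasDerivAt_const θ 1)
    refine eq_of_dotProduct_eq (hX.det_ne_zero hI θ) ?_ ?_
    · rw [← hp', hp0, zero_dotProduct, mul_zero]
    · rw [zero_dotProduct]
      rw [hq0] at hq'
      linear_combination -hq'
  · simp only [innerL2, e1, phaseAvg_const]
  · simp only [innerL2, e2, phaseAvg_const]

/-- Here the residual pairs to `0` with `∂_θ X` and to `Ω'` with `∂_I X`, which identifies it as `Ω'
Z^I`. -/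
theorem isPhaseMode_dualFst (hX : IsGoodwinFamily m 𝓘 X Ω) (hI : I ∈ 𝓘) :
    IsPhaseMode m X Ω I (fun θ => dualSnd (dPhase X θ I) (dAmp X θ I))
      (fun θ => dualFst (dPhase X θ I) (dAmp X θ I)) := by
  have hZ := hX.differentiable_phase_slice (f := fun θ I => dualFst (dPhase X θ I) (dAmp X θ I))
    hX.contDiffOn_dualFst hI
  have e1 : ∀ θ, dualFst (dPhase X θ I) (dAmp X θ I) ⬝ᵥ dPhase X θ I = 1 := fun θ =>
    dualFst_dotProduct_fst (hX.det_ne_zero hI θ)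
  have e2 : ∀ θ, dualFst (dPhase X θ I) (dAmp X θ I) ⬝ᵥ dAmp X θ I = 0 := fun θ =>
    dualFst_dotProduct_snd
  refine ⟨hZ, fun θ => ?_, fun θ => ?_, ?_, ?_⟩
  · have h1 := hX.periodic_dPhase hI θ
    have h2 := hX.periodic_dAmp hI θ
    simp only at h1 h2
    simp only [h1, h2]
  · obtain ⟨p, hp, hp'⟩ := hX.exists_hasDerivAt_dotProduct_dPhase hI hZ θ
    obtain ⟨q, hq, hq'⟩ := hX.exists_hasDerivAt_dotProduct_dAmp hI hZ θ
    simp only [e1] at hp hq'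
    simp only [e2] at hq
    have hp0 := hp.unique (hasDerivAt_const θ 1)
    have hq0 := hq.unique (hasDerivAt_const θ 0)
    refine eq_of_dotProduct_eq (hX.det_ne_zero hI θ) ?_ ?_
    · rw [← hp', hp0, smul_dotProduct, dualSnd_dotProduct_fst, smul_zero, mul_zero]
    · rw [smul_dotProduct, dualSnd_dotProduct_snd (hX.det_ne_zero hI θ), smul_eq_mul]
      rw [hq0] at hq'
      linear_combination -hq'
  · simp only [innerL2, e1, phaseAvg_const]
  · simp only [innerL2, e2, phaseAvg_const]

theorem _root_.IsAmplitudeMode.eq_dualSnd (hX : IsGoodwinFamily m 𝓘 X Ω) (hI : I ∈ 𝓘)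
    {Z : ℝ → Fin 2 → ℝ} (hZ : IsAmplitudeMode m X Ω I Z) (θ : ℝ) :
    Z θ = dualSnd (dPhase X θ I) (dAmp X θ I) := by
  obtain ⟨hd, -, hode, h0, h1⟩ := hZ
  have hΩ := (hX.freq_pos I hI).ne'
  have e1 : ∀ θ, Z θ ⬝ᵥ dPhase X θ I = 0 := eq_const_of_phaseAvg (fun θ => by
    obtain ⟨p, hp, hp'⟩ := hX.exists_hasDerivAt_dotProduct_dPhase hI hd θ
    rw [hode, zero_dotProduct] at hp'
    rwa [(mul_eq_zero.mp hp').resolve_left hΩ] at hp) h0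
  -- The pairing with `∂_θ X` has to be known first: it is the source term here.
  have e2 : ∀ θ, Z θ ⬝ᵥ dAmp X θ I = 1 := eq_const_of_phaseAvg (fun θ => by
    obtain ⟨p, hp, hp'⟩ := hX.exists_hasDerivAt_dotProduct_dAmp hI hd θ
    rw [hode, zero_dotProduct, e1, mul_zero, sub_zero] at hp'
    rwa [(mul_eq_zero.mp hp').resolve_left hΩ] at hp) h1
  refine eq_of_dotProduct_eq (hX.det_ne_zero hI θ) ?_ ?_
  · rw [e1, dualSnd_dotProduct_fst]
  · rw [e2, dualSnd_dotProduct_snd (hX.det_ne_zero hI θ)]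

theorem _root_.IsPhaseMode.eq_dualFst (hX : IsGoodwinFamily m 𝓘 X Ω) (hI : I ∈ 𝓘)
    {Y Z : ℝ → Fin 2 → ℝ} (hZ : IsPhaseMode m X Ω I Y Z) (hY : IsAmplitudeMode m X Ω I Y) (θ : ℝ) :
    Z θ = dualFst (dPhase X θ I) (dAmp X θ I) := by
  obtain ⟨hd, -, hode, h0, h1⟩ := hZ
  have hΩ := (hX.freq_pos I hI).ne'
  have hYe := hY.eq_dualSnd hX hI
  have e1 : ∀ θ, Z θ ⬝ᵥ dPhase X θ I = 1 := eq_const_of_phaseAvg (fun θ => by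
    obtain ⟨p, hp, hp'⟩ := hX.exists_hasDerivAt_dotProduct_dPhase hI hd θ
    rw [hode, smul_dotProduct, hYe, dualSnd_dotProduct_fst, smul_zero] at hp'
    rwa [(mul_eq_zero.mp hp').resolve_left hΩ] at hp) h0
  have e2 : ∀ θ, Z θ ⬝ᵥ dAmp X θ I = 0 := eq_const_of_phaseAvg (fun θ => by
    obtain ⟨p, hp, hp'⟩ := hX.exists_hasDerivAt_dotProduct_dAmp hI hd θ
    rw [hode, smul_dotProduct, hYe, dualSnd_dotProduct_snd (hX.det_ne_zero hI θ), e1, smul_eq_mul,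
      sub_self] at hp'
    rwa [(mul_eq_zero.mp hp').resolve_left hΩ] at hp) h1
  refine eq_of_dotProduct_eq (hX.det_ne_zero hI θ) ?_ ?_
  · rw [e1, dualFst_dotProduct_fst (hX.det_ne_zero hI θ)]
  · rw [e2, dualFst_dotProduct_snd]

theorem existsUnique_modes (hX : IsGoodwinFamily m 𝓘 X Ω) (hI : I ∈ 𝓘) :
    ∃! Z : (ℝ → Fin 2 → ℝ) × (ℝ → Fin 2 → ℝ),
      IsPhaseMode m X Ω I Z.2 Z.1 ∧ IsAmplitudeMode m X Ω I Z.2 := by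
  refine ⟨(_, _), ⟨hX.isPhaseMode_dualFst hI, hX.isAmplitudeMode_dualSnd hI⟩, ?_⟩
  rintro ⟨Z, Y⟩ ⟨hZ, hY⟩
  exact Prod.ext (funext (hZ.eq_dualFst hX hI hY)) (funext (hY.eq_dualSnd hX hI))

/-! ### The cycle debt and the forcing. -/

theorem hasDerivAt_employment (hX : IsGoodwinFamily m 𝓘 X Ω) (hI : I ∈ 𝓘) (θ : ℝ) :
    HasDerivAt (fun θ => X θ I 1)
      ((Ω I)⁻¹ * (X θ I 1 * (m.κ (1 - X θ I 0) / m.ν - m.α - m.β - m.δ))) θ := by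
  have h := hasDerivAt_pi.mp (hX.hasDerivAt_phase hI θ) 1
  have h2 := congrFun (hX.cycle I hI θ) 1
  simp only [F₀, Pi.smul_apply, smul_eq_mul, cons_val_one, cons_val_fin_one] at h2
  rw [← h2, inv_mul_cancel_left₀ (hX.freq_pos I hI).ne']
  exact h

/-- Multiplying debt by employment cancels `κ/ν` and `δ` and leaves the constant decay rate `(α +
β)/Ω`; dividing by `λ > 0` recovers `d₀`. -/
theorem exists_contDiffOn_cycleDebt (hX : IsGoodwinFamily m 𝓘 X Ω) :
    ∃ D : ℝ → ℝ → ℝ, ContDiffOn ℝ 1 (fun p : ℝ × ℝ => D p.1 p.2) (univ ×ˢ 𝓘) ∧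
      ∀ I ∈ 𝓘, IsCycleDebt m X Ω I (fun θ => D θ I) := by
  have hΩ1 : ContDiffOn ℝ 1 Ω 𝓘 := hX.contDiffOn_freq.of_le one_le_two
  have hΩi : ContDiffOn ℝ 1 (fun I => (Ω I)⁻¹) 𝓘 := hΩ1.inv fun I hI => (hX.freq_pos I hI).ne'
  have hXc := contDiffOn_pi.mp (hX.contDiffOn.of_le one_le_two)
  have hκ : ContDiffOn ℝ 1 (fun p : ℝ × ℝ => m.κ (1 - X p.1 p.2 0)) (univ ×ˢ 𝓘) :=
    m.κ_contDiff.comp_contDiffOn (contDiffOn_const.sub (hXc 0))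
  have hγ : 0 < m.α + m.β := add_pos m.α_pos m.β_pos
  obtain ⟨e, hec, hep, hed⟩ := exists_periodic_linear_solution hX.isOpen
    (k := fun I => (m.α + m.β) * (Ω I)⁻¹) (contDiffOn_const.mul hΩi)
    (fun I hI => mul_pos hγ (inv_pos.mpr (hX.freq_pos I hI)))
    (g := fun θ I => (Ω I)⁻¹ * (X θ I 1 * (m.κ (1 - X θ I 0) - (1 - X θ I 0))))
    ((contDiffOn_comp_snd hΩi).mul ((hXc 1).mul (hκ.sub (contDiffOn_const.sub (hXc 0)))))
    (fun I hI θ => by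
      have := hX.periodic I hI θ
      simp only at this
      simp only [this])
  have hlam : ∀ I ∈ 𝓘, ∀ θ, X θ I 1 ≠ 0 := fun I hI θ => (hX.employment_mem I hI θ).1.ne'
  refine ⟨fun θ I => e θ I / X θ I 1, hec.div (hXc 1) fun p hp => hlam p.2 hp.2 p.1, ?_⟩
  intro I hI
  have hd := fun θ => (hed I hI θ).fun_div (hX.hasDerivAt_employment hI θ) (hlam I hI θ)
  refine ⟨fun θ => (hd θ).differentiableAt, fun θ => ?_, fun θ => ?_⟩
  · have h1 := hX.periodic I hI θ
    have h2 := hep I hI θ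
    simp only at h1 h2
    simp only [h1, h2]
  · rw [(hd θ).deriv]
    have h1 := hlam I hI θ
    have h2 := (hX.freq_pos I hI).ne'
    have h3 := m.ν_pos.ne'
    field_simp
    ring

/-- For two solutions, `exp(kθ) λ (d - e)` is constant, while a period shift multiplies it by
`exp(2πk) > 1`; so it is zero. -/
theorem _root_.IsCycleDebt.unique (hX : IsGoodwinFamily m 𝓘 X Ω) (hI : I ∈ 𝓘) {d e : ℝ → ℝ}
    (hd : IsCycleDebt m X Ω I d) (he : IsCycleDebt m X Ω I e) : d = e := by
  obtain ⟨hd1, hd2, hd3⟩ := hd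
  obtain ⟨he1, he2, he3⟩ := he
  have hΩ := hX.freq_pos I hI
  set k := (m.α + m.β) * (Ω I)⁻¹ with hk
  have hkpos : 0 < k := mul_pos (add_pos m.α_pos m.β_pos) (inv_pos.mpr hΩ)
  have hH : ∀ θ, HasDerivAt (fun θ => exp (k * θ) * (X θ I 1 * (d θ - e θ))) 0 θ := by
    intro θ
    have h1 : HasDerivAt (fun θ => exp (k * θ)) (exp (k * θ) * (k * 1)) θ :=
      ((hasDerivAt_id' θ).const_mul k).exp
    refine (h1.fun_mul ((hX.hasDerivAt_employment hI θ).fun_mul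
      ((hd1 θ).hasDerivAt.fun_sub (he1 θ).hasDerivAt))).congr_deriv ?_
    have h4 : deriv d θ = (Ω I)⁻¹ * ((m.δ - m.κ (1 - X θ I 0) / m.ν) * d θ
        + (m.κ (1 - X θ I 0) - (1 - X θ I 0))) := by
      rw [← hd3, inv_mul_cancel_left₀ hΩ.ne']
    have h5 : deriv e θ = (Ω I)⁻¹ * ((m.δ - m.κ (1 - X θ I 0) / m.ν) * e θ
        + (m.κ (1 - X θ I 0) - (1 - X θ I 0))) := by
      rw [← he3, inv_mul_cancel_left₀ hΩ.ne']
    rw [h4, h5, hk]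
    ring
  funext θ
  have h6 := is_const_of_deriv_eq_zero (fun θ => (hH θ).differentiableAt)
    (fun θ => (hH θ).deriv) (θ + 2 * π) θ
  have hXp := hX.periodic I hI θ
  simp only at hXp
  simp only [hXp, hd2 θ, he2 θ] at h6
  have h7 : exp (k * θ) < exp (k * (θ + 2 * π)) :=
    exp_lt_exp.mpr (mul_lt_mul_of_pos_left (by linarith [pi_pos]) hkpos)
  have h8 : (exp (k * (θ + 2 * π)) - exp (k * θ)) * (X θ I 1 * (d θ - e θ)) = 0 := by
    linear_combination h6
  have h9 := (mul_eq_zero.mp h8).resolve_left (sub_pos.mpr h7).ne'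
  exact sub_eq_zero.mp ((mul_eq_zero.mp h9).resolve_left (hX.employment_mem I hI θ).1.ne')

theorem existsUnique_cycleDebt (hX : IsGoodwinFamily m 𝓘 X Ω) (hI : I ∈ 𝓘) :
    ∃! d : ℝ → ℝ, IsCycleDebt m X Ω I d := by
  obtain ⟨D, -, hD⟩ := hX.exists_contDiffOn_cycleDebt
  exact ⟨_, hD I hI, fun e he => he.unique hX hI (hD I hI)⟩

/-- Uniqueness at each amplitude transfers joint regularity from the constructed family to any given
`d₀`. -/
theorem contDiffOn_cycleDebt (hX : IsGoodwinFamily m 𝓘 X Ω) {d₀ : ℝ → ℝ → ℝ}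
    (hd : ∀ I ∈ 𝓘, IsCycleDebt m X Ω I (fun θ => d₀ θ I)) :
    ContDiffOn ℝ 1 (fun p : ℝ × ℝ => d₀ p.1 p.2) (univ ×ˢ 𝓘) := by
  obtain ⟨D, hDc, hD⟩ := hX.exists_contDiffOn_cycleDebt
  exact hDc.congr fun p hp => congrFun ((hd p.2 hp.2).unique hX hp.2 (hD p.2 hp.2)) p.1

theorem contDiffOn_cycleForcing (hX : IsGoodwinFamily m 𝓘 X Ω) {d₀ : ℝ → ℝ → ℝ}
    (hd : ∀ I ∈ 𝓘, IsCycleDebt m X Ω I (fun θ => d₀ θ I)) :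
    ContDiffOn ℝ 1 (fun p : ℝ × ℝ => cycleForcing m X d₀ p.1 p.2) (univ ×ˢ 𝓘) := by
  have hXc := contDiffOn_pi.mp (hX.contDiffOn.of_le one_le_two)
  have hκ : ContDiffOn ℝ 1 (fun p : ℝ × ℝ => deriv m.κ (1 - X p.1 p.2 0)) (univ ×ˢ 𝓘) :=
    m.contDiffOn_deriv.comp (contDiffOn_const.sub (hXc 0))
      (fun p hp => hX.κ_contDiffAt p.2 hp.2 p.1)
  exact contDiffOn_vec2 contDiffOn_const
    ((((hXc 1).mul hκ).mul (hX.contDiffOn_cycleDebt hd)).div_const _).neg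

theorem periodic_cycleForcing (hX : IsGoodwinFamily m 𝓘 X Ω) {d₀ : ℝ → ℝ → ℝ}
    (hd : ∀ I ∈ 𝓘, IsCycleDebt m X Ω I (fun θ => d₀ θ I)) (hI : I ∈ 𝓘) :
    Function.Periodic (fun θ => cycleForcing m X d₀ θ I) (2 * π) := by
  intro θ
  have h1 := hX.periodic I hI θ
  have h2 := (hd I hI).2.1 θ
  simp only at h1 h2
  simp only [cycleForcing, h1, h2]

end IsGoodwinFamily

/-! ### The phase–amplitude equation and its projection. -/

variable {d₀ : ℝ → ℝ → ℝ}

namespace IsGoodwinFamily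

theorem hasDerivAt_curve (hX : IsGoodwinFamily m 𝓘 X Ω) {θ I : ℝ → ℝ} {t : ℝ} (hI : I t ∈ 𝓘)
    (hθ : DifferentiableAt ℝ θ t) (hId : DifferentiableAt ℝ I t) :
    HasDerivAt (fun t => X (θ t) (I t))
      (deriv θ t • dPhase X (θ t) (I t) + deriv I t • dAmp X (θ t) (I t)) t := by
  rw [hX.dPhase_eq hI, hX.dAmp_eq hI]
  exact HasFDerivAt.hasDerivAt_curve (hX.hasFDerivAt hI (θ t)) hθ hId

/-- Uniform second-order expansion of the investment function along the cycles. -/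
theorem exists_investment_taylor (hX : IsGoodwinFamily m 𝓘 X Ω) {a b : ℝ} (hab : Icc a b ⊆ 𝓘) :
    ∃ M P ε, 0 ≤ M ∧ 0 ≤ P ∧ 0 < ε ∧ ∀ θ, ∀ I ∈ Icc a b, |deriv m.κ (1 - X θ I 0)| ≤ P ∧
      ∀ h, |h| ≤ ε → |m.κ (1 - X θ I 0 + h) - m.κ (1 - X θ I 0) - deriv m.κ (1 - X θ I 0) * h|
        ≤ M * h ^ 2 := by
  have hXc := contDiffOn_pi.mp (hX.contDiffOn.of_le one_le_two)
  set K := (fun p : ℝ × ℝ => 1 - X p.1 p.2 0) '' (Icc 0 (2 * π) ×ˢ Icc a b) with hK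
  have hKc : IsCompact K := (isCompact_Icc.prod isCompact_Icc).image_of_continuousOn
    ((contDiffOn_const.sub (hXc 0)).continuousOn.mono (prod_mono (subset_univ _) hab))
  have hKU : K ⊆ {x | ContDiffAt ℝ 2 m.κ x} := by
    rintro _ ⟨p, hp, rfl⟩
    exact hX.κ_contDiffAt p.2 (hab hp.2) p.1
  have hmem : ∀ θ, ∀ I ∈ Icc a b, 1 - X θ I 0 ∈ K := by
    intro θ I hI
    obtain ⟨y, hy, hy'⟩ := (hX.periodic I (hab hI)).exists_mem_Ico₀ (by positivity) θ
    exact ⟨(y, I), ⟨Ico_subset_Icc_self hy, hI⟩, by simp only at hy' ⊢; rw [hy']⟩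
  obtain ⟨M, ε, hM, hε, H⟩ := exists_uniform_taylor m.isOpen_smooth hKc hKU m.contDiffOn_smooth
  obtain ⟨P, hP⟩ := hKc.exists_bound_of_continuousOn (m.contDiffOn_deriv.continuousOn.mono hKU)
  exact ⟨M, max P 0, ε, hM, le_max_right _ _, hε, fun θ I hI =>
    ⟨(hP _ (hmem θ I hI)).trans (le_max_left _ _), fun h hh => (H _ (hmem θ I hI) h hh).2⟩⟩

/-- The Keen dynamics near the family obeys the phase--amplitude equation. -/
theorem exists_phaseAmplitude_remainder (hX : IsGoodwinFamily m 𝓘 X Ω)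
    (hd : ∀ I ∈ 𝓘, IsCycleDebt m X Ω I (fun θ => d₀ θ I)) {a b : ℝ} (C : ℝ) (hab : Icc a b ⊆ 𝓘) :
    ∃ C' r₀ : ℝ, 0 < r₀ ∧ ∀ r : ℝ, |r| < r₀ →
      ∀ (θ I d : ℝ → ℝ) (s : Set ℝ), (∀ t ∈ s, I t ∈ Icc a b) →
        (∀ t ∈ s, DifferentiableAt ℝ θ t ∧ DifferentiableAt ℝ I t) →
        SolvesKeen m r (fun t => X (θ t) (I t) 0) (fun t => X (θ t) (I t) 1) d s →
        (∀ t ∈ s, |d t - d₀ (θ t) (I t)| ≤ C * |r|) →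
        SolvesPhaseAmplitude m X Ω d₀ r C' θ I s := by
  obtain ⟨M, P, ε, hM, hP, hε, H⟩ := hX.exists_investment_taylor hab
  obtain ⟨D, hD, hDb⟩ := exists_bound_of_periodic (hX.contDiffOn_cycleDebt hd).continuousOn
    (fun I hI => (hd I hI).2.1) hab
  have hν := m.ν_pos
  have hDC : 0 ≤ D + |C| := by positivity
  -- `D + |C|` bounds `|d|` once `|r| ≤ 1`. The first summand is the Taylor error of `κ`, the second
  -- the cost of replacing `d` by `d₀`; the second bound on `r₀` keeps `r d` within the Taylor
  -- range.
  refine ⟨(M * (D + |C|) ^ 2 + P * |C|) / m.ν, min 1 (ε / (D + |C| + 1)),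
    lt_min one_pos (by positivity), ?_⟩
  intro r hr θ I d s hI hdiff hK hds t ht
  obtain ⟨hθd, hId⟩ := hdiff t ht
  refine ⟨hθd, hId, ?_⟩
  have hI' := hab (hI t ht)
  obtain ⟨hκ', hT⟩ := H (θ t) (I t) (hI t ht)
  have hr1 : |r| ≤ 1 := (hr.trans_le (min_le_left _ _)).le
  have hrε : |r| * (D + |C| + 1) ≤ ε :=
    (le_div_iff₀ (by positivity)).mp (hr.trans_le (min_le_right _ _)).le
  have hdC : |d t - d₀ (θ t) (I t)| ≤ |C| * |r| :=
    (hds t ht).trans (mul_le_mul_of_nonneg_right (le_abs_self C) (abs_nonneg r))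
  have hdb : |d t| ≤ D + |C| := by
    have h1 := hDb (θ t) (I t) (hI t ht)
    rw [Real.norm_eq_abs] at h1
    have h2 := abs_sub_abs_le_abs_sub (d t) (d₀ (θ t) (I t))
    have h3 : |C| * |r| ≤ |C| := mul_le_of_le_one_right (abs_nonneg C) hr1
    linarith
  have hrd : |-(r * d t)| ≤ ε := by
    rw [abs_neg, abs_mul]
    refine (mul_le_mul_of_nonneg_left hdb (abs_nonneg r)).trans (le_trans ?_ hrε)
    exact mul_le_mul_of_nonneg_left (by linarith) (abs_nonneg r)
  have hT' := hT _ hrd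
  have hcurve := hasDerivAt_pi.mp (hX.hasDerivAt_curve hI' hθd hId)
  obtain ⟨hω, hlam, -⟩ := hK t ht
  have e0 := (hcurve 0).unique hω
  have e1 := (hcurve 1).unique hlam
  have hc := hX.cycle (I t) hI' (θ t)
  have c0 := congrFun hc 0
  have c1 := congrFun hc 1
  simp only [F₀, Pi.smul_apply, Pi.add_apply, smul_eq_mul, cons_val_zero, cons_val_one,
    cons_val_fin_one] at e0 e1 c0 c1
  have hC' : 0 ≤ (M * (D + |C|) ^ 2 + P * |C|) / m.ν * r ^ 2 := by positivity
  rw [pi_norm_le_iff_of_nonneg hC']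
  intro i
  fin_cases i
  · simp only [Fin.zero_eta, cycleForcing, forcing, Pi.sub_apply, Pi.add_apply, Pi.smul_apply,
      smul_eq_mul, cons_val_zero]
    -- The wage equation does not contain `r`, so its residual is exactly zero.
    rw [show (deriv θ t - Ω (I t)) * dPhase X (θ t) (I t) 0 + deriv I t * dAmp X (θ t) (I t) 0
      - r * 0 = 0 by linear_combination e0 - c0, norm_zero]
    exact hC'
  · simp only [Fin.mk_one, cycleForcing, forcing, Pi.sub_apply, Pi.add_apply, Pi.smul_apply,
      smul_eq_mul, cons_val_one, cons_val_fin_one]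
    obtain ⟨hl0, hl1⟩ := hX.employment_mem (I t) hI' (θ t)
    set x := 1 - X (θ t) (I t) 0 with hx
    have key : (deriv θ t - Ω (I t)) * dPhase X (θ t) (I t) 1 + deriv I t * dAmp X (θ t) (I t) 1
        - r * -(X (θ t) (I t) 1 * deriv m.κ x * d₀ (θ t) (I t) / m.ν)
        = X (θ t) (I t) 1 * (((m.κ (x + -(r * d t)) - m.κ x - deriv m.κ x * -(r * d t))
          - deriv m.κ x * (r * (d t - d₀ (θ t) (I t)))) / m.ν) := by
      rw [← sub_eq_add_neg x]
      linear_combination e1 - c1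
    rw [key, Real.norm_eq_abs, abs_mul, abs_of_pos hl0, abs_div, abs_of_pos hν]
    refine (mul_le_of_le_one_left (by positivity) hl1.le).trans ?_
    rw [div_mul_eq_mul_div]
    refine div_le_div_of_nonneg_right ?_ hν.le
    refine (abs_sub _ _).trans ?_
    rw [add_mul]
    refine add_le_add (hT'.trans ?_) ?_
    · rw [mul_assoc, neg_sq, mul_pow, mul_comm (r ^ 2)]
      refine mul_le_mul_of_nonneg_left (mul_le_mul_of_nonneg_right ?_ (sq_nonneg r)) hM
      exact sq_le_sq' (by linarith [neg_abs_le (d t)]) ((le_abs_self _).trans hdb)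
    · rw [abs_mul, abs_mul, mul_assoc]
      refine mul_le_mul hκ' ?_ (by positivity) hP
      rw [← sq_abs r, pow_two, ← mul_assoc, mul_comm |r|]
      exact mul_le_mul_of_nonneg_right hdC (abs_nonneg r)

variable {Zθ ZI : ℝ → ℝ → Fin 2 → ℝ}

/-- The definition of a mode concerns one amplitude at a time; identification with the dual basis
supplies the joint regularity needed for averaging. -/
theorem contDiffOn_amplitudeMode (hX : IsGoodwinFamily m 𝓘 X Ω)
    (hZI : ∀ I ∈ 𝓘, IsAmplitudeMode m X Ω I (fun θ => ZI θ I)) :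
    ContDiffOn ℝ 1 (fun p : ℝ × ℝ => ZI p.1 p.2) (univ ×ˢ 𝓘) :=
  hX.contDiffOn_dualSnd.congr fun p hp => (hZI p.2 hp.2).eq_dualSnd hX hp.2 p.1

theorem contDiffOn_phaseMode (hX : IsGoodwinFamily m 𝓘 X Ω)
    (hZθ : ∀ I ∈ 𝓘, IsPhaseMode m X Ω I (fun θ => ZI θ I) (fun θ => Zθ θ I))
    (hZI : ∀ I ∈ 𝓘, IsAmplitudeMode m X Ω I (fun θ => ZI θ I)) :
    ContDiffOn ℝ 1 (fun p : ℝ × ℝ => Zθ p.1 p.2) (univ ×ˢ 𝓘) :=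
  hX.contDiffOn_dualFst.congr fun p hp => (hZθ p.2 hp.2).eq_dualFst hX hp.2 (hZI p.2 hp.2) p.1

/-- Projection of the phase--amplitude equation onto the adjoint modes. -/
theorem exists_projection_bound (hX : IsGoodwinFamily m 𝓘 X Ω)
    (hZθ : ∀ I ∈ 𝓘, IsPhaseMode m X Ω I (fun θ => ZI θ I) (fun θ => Zθ θ I))
    (hZI : ∀ I ∈ 𝓘, IsAmplitudeMode m X Ω I (fun θ => ZI θ I))
    {a b : ℝ} (C : ℝ) (hab : Icc a b ⊆ 𝓘) :
    ∃ C' : ℝ, 0 ≤ C' ∧ ∀ (r : ℝ) (θ I : ℝ → ℝ) (s : Set ℝ),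
      (∀ t ∈ s, I t ∈ Icc a b) → SolvesPhaseAmplitude m X Ω d₀ r C θ I s →
      ∀ t ∈ s,
        |deriv θ t - Ω (I t) - r * (Zθ (θ t) (I t) ⬝ᵥ cycleForcing m X d₀ (θ t) (I t))|
          ≤ C' * r ^ 2 ∧
        |deriv I t - r * (ZI (θ t) (I t) ⬝ᵥ cycleForcing m X d₀ (θ t) (I t))| ≤ C' * r ^ 2 := by
  obtain ⟨A, hA, hAb⟩ := exists_bound_of_periodic
    (hX.contDiffOn_phaseMode hZθ hZI).continuousOn (fun I hI => (hZθ I hI).2.1) hab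
  obtain ⟨B, hB, hBb⟩ := exists_bound_of_periodic
    (hX.contDiffOn_amplitudeMode hZI).continuousOn (fun I hI => (hZI I hI).2.1) hab
  -- The factor `2` is the price of the sup norm in the dot product on the plane.
  refine ⟨2 * max A B * |C|, by positivity, fun r θ I s hI hs t ht => ?_⟩
  obtain ⟨-, -, hres⟩ := hs t ht
  have hI' := hab (hI t ht)
  have hres' := hres.trans (mul_le_mul_of_nonneg_right (le_abs_self C) (sq_nonneg r))
  have hdet := hX.det_ne_zero hI' (θ t)
  have key : ∀ Z : Fin 2 → ℝ, ‖Z‖ ≤ max A B →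
      |Z ⬝ᵥ ((deriv θ t - Ω (I t)) • dPhase X (θ t) (I t) + deriv I t • dAmp X (θ t) (I t)
        - r • cycleForcing m X d₀ (θ t) (I t))| ≤ 2 * max A B * |C| * r ^ 2 := by
    intro Z hZ
    refine (abs_dotProduct_le_two _ _).trans ?_
    rw [mul_assoc (2 * max A B)]
    exact mul_le_mul (by linarith) hres' (norm_nonneg _) (by positivity)
  constructor
  · have h := key _ ((hAb (θ t) (I t) (hI t ht)).trans (le_max_left A B))
    rw [dotProduct_sub, dotProduct_add, dotProduct_smul, dotProduct_smul, dotProduct_smul,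
      smul_eq_mul, smul_eq_mul, smul_eq_mul] at h
    have e := (hZθ (I t) hI').eq_dualFst hX hI' (hZI (I t) hI') (θ t)
    have e1 : Zθ (θ t) (I t) ⬝ᵥ dPhase X (θ t) (I t) = 1 := by
      rw [e, dualFst_dotProduct_fst hdet]
    have e2 : Zθ (θ t) (I t) ⬝ᵥ dAmp X (θ t) (I t) = 0 := by
      rw [e, dualFst_dotProduct_snd]
    rwa [e1, e2, mul_one, mul_zero, add_zero] at h
  · have h := key _ ((hBb (θ t) (I t) (hI t ht)).trans (le_max_right A B))
    rw [dotProduct_sub, dotProduct_add, dotProduct_smul, dotProduct_smul, dotProduct_smul,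
      smul_eq_mul, smul_eq_mul, smul_eq_mul] at h
    have e := (hZI (I t) hI').eq_dualSnd hX hI' (θ t)
    have e1 : ZI (θ t) (I t) ⬝ᵥ dPhase X (θ t) (I t) = 0 := by
      rw [e, dualSnd_dotProduct_fst]
    have e2 : ZI (θ t) (I t) ⬝ᵥ dAmp X (θ t) (I t) = 1 := by
      rw [e, dualSnd_dotProduct_snd hdet]
    rwa [e1, e2, mul_one, mul_zero, zero_add] at h

end IsGoodwinFamily

/-! ### Averaging in near-identity variables. -/

/-- The remainder left by a near-identity change of variables is of second order. -/
theorem abs_averaging_remainder_le {r ρ ρ₁ ρ₂ τ σ p q f g c T S L B : ℝ} (hr : |r| ≤ 1)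
    (hc : 0 ≤ c) (hL : 0 ≤ L) (hρ : |ρ| ≤ c * r ^ 2) (hρ₁ : |ρ₁| ≤ c * r ^ 2)
    (hρ₂ : |ρ₂| ≤ c * r ^ 2) (hτ : |τ| ≤ T * r ^ 2) (hσ : |σ| ≤ S * |r|) (hp : |p| ≤ L)
    (hq : |q| ≤ L) (hf : |f| ≤ B) (hg : |g| ≤ B) :
    |ρ - τ - r * σ - r * (p * (r * f + ρ₁) + q * (r * g + ρ₂))|
      ≤ (c + T + S + 2 * (L * (B + c))) * r ^ 2 := by
  -- In the application `ρ` is a projection error, `τ` the Taylor error of `Ω`, `σ` the change of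
  -- the averaged coefficient under the amplitude shift, and `p`, `q` the partials of a corrector;
  -- `r f + ρ₁` and `r g + ρ₂` are `θ' - Ω` and `I'`.
  have hsq : |r| * |r| = r ^ 2 := by rw [← pow_two, sq_abs]
  have h1 : ∀ {x y z : ℝ}, |x| ≤ L → |y| ≤ B → |z| ≤ c * r ^ 2 →
      |x * (r * y + z)| ≤ L * (B + c) * |r| := by
    intro x y z hx hy hz
    rw [abs_mul, mul_assoc]
    refine mul_le_mul hx ((abs_add_le _ _).trans ?_) (abs_nonneg _) hL
    rw [abs_mul, add_mul, mul_comm B]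
    refine add_le_add (mul_le_mul_of_nonneg_left hy (abs_nonneg r)) (hz.trans ?_)
    refine mul_le_mul_of_nonneg_left ?_ hc
    rw [← hsq]
    exact mul_le_of_le_one_left (abs_nonneg r) hr
  have h2 : |r * σ| ≤ S * r ^ 2 := by
    rw [abs_mul, ← hsq]
    calc |r| * |σ| ≤ |r| * (S * |r|) := mul_le_mul_of_nonneg_left hσ (abs_nonneg r)
      _ = S * (|r| * |r|) := by ring
  have h3 : |r * (p * (r * f + ρ₁) + q * (r * g + ρ₂))| ≤ 2 * (L * (B + c)) * r ^ 2 := by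
    rw [abs_mul, ← hsq]
    calc _ ≤ |r| * (L * (B + c) * |r| + L * (B + c) * |r|) :=
          mul_le_mul_of_nonneg_left ((abs_add_le _ _).trans
            (add_le_add (h1 hp hf hρ₁) (h1 hq hg hρ₂))) (abs_nonneg r)
      _ = 2 * (L * (B + c)) * (|r| * |r|) := by ring
  refine (abs_sub _ _).trans ?_
  have h4 := abs_sub (ρ - τ) (r * σ)
  have h5 := abs_sub ρ τ
  linarith

namespace IsGoodwinFamily

/-- The correctors of the near-identity transformation solve the homological equations. -/
theorem exists_averaging_correctors (hX : IsGoodwinFamily m 𝓘 X Ω) {f g : ℝ → ℝ → ℝ}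
    (hf : ContDiffOn ℝ 1 (fun p : ℝ × ℝ => f p.1 p.2) (univ ×ˢ 𝓘))
    (hfp : ∀ I ∈ 𝓘, Function.Periodic (fun θ => f θ I) (2 * π))
    (hg : ContDiffOn ℝ 1 (fun p : ℝ × ℝ => g p.1 p.2) (univ ×ˢ 𝓘))
    (hgp : ∀ I ∈ 𝓘, Function.Periodic (fun θ => g θ I) (2 * π)) :
    ∃ w u : ℝ → ℝ → ℝ, IsCorrector 𝓘 w ∧ IsCorrector 𝓘 u ∧ ∀ I ∈ 𝓘, ∀ θ,
      Ω I * fderiv ℝ (fun p : ℝ × ℝ => w p.1 p.2) (θ, I) (1, 0)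
        = f θ I - phaseAvg (fun θ => f θ I) + deriv Ω I * u θ I ∧
      Ω I * fderiv ℝ (fun p : ℝ × ℝ => u p.1 p.2) (θ, I) (1, 0)
        = g θ I - phaseAvg (fun θ => g θ I) := by
  have hΩ1 : ContDiffOn ℝ 1 Ω 𝓘 := hX.contDiffOn_freq.of_le one_le_two
  have hcont : ∀ {h : ℝ → ℝ → ℝ}, ContDiffOn ℝ 1 (fun p : ℝ × ℝ => h p.1 p.2) (univ ×ˢ 𝓘) →
      ∀ I ∈ 𝓘, Continuous fun θ => h θ I := fun hh I hI =>
    continuous_phase_slice hh.continuousOn hI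
  have hzero : ∀ {h : ℝ → ℝ → ℝ}, ContDiffOn ℝ 1 (fun p : ℝ × ℝ => h p.1 p.2) (univ ×ˢ 𝓘) →
      ∀ I ∈ 𝓘, phaseAvg (fun θ => h θ I - phaseAvg fun θ => h θ I) = 0 := fun hh I hI => by
    rw [phaseAvg_sub (hcont hh I hI) continuous_const, phaseAvg_const, sub_self]
  have hsolve : ∀ {v h : ℝ → ℝ → ℝ}, IsCorrector 𝓘 v →
      (∀ I ∈ 𝓘, ∀ θ, HasDerivAt (fun θ => v θ I) ((Ω I)⁻¹ * h θ I) θ) → ∀ I ∈ 𝓘, ∀ θ,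
        Ω I * fderiv ℝ (fun p : ℝ × ℝ => v p.1 p.2) (θ, I) (1, 0) = h θ I := by
    intro v h hv hd I hI θ
    have h1 := HasFDerivAt.hasDerivAt_phase ((hv.contDiffOn.contDiffAt (hX.isOpen_dom.mem_nhds
      (show (θ, I) ∈ _ from ⟨mem_univ _, hI⟩))).differentiableAt one_ne_zero).hasFDerivAt
    rw [h1.unique (hd I hI θ), mul_inv_cancel_left₀ (hX.freq_pos I hI).ne']
  -- The corrector `u` comes first: it enters the equation for `w`, and its zero mean makes that
  -- equation solvable.
  obtain ⟨u, hu, hud⟩ := exists_corrector hX.isOpen hΩ1 hX.freq_pos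
    (f := fun θ I => g θ I - phaseAvg fun θ => g θ I)
    (hg.sub (contDiffOn_comp_snd (contDiffOn_phaseAvg hX.isOpen hg)))
    (fun I hI θ => congrArg (· - phaseAvg fun θ => g θ I) (hgp I hI θ)) (hzero hg)
  obtain ⟨w, hw, hwd⟩ := exists_corrector hX.isOpen hΩ1 hX.freq_pos
    (f := fun θ I => f θ I - (phaseAvg fun θ => f θ I) + deriv Ω I * u θ I)
    ((hf.sub (contDiffOn_comp_snd (contDiffOn_phaseAvg hX.isOpen hf))).add
      ((contDiffOn_comp_snd (hX.contDiffOn_freq.deriv_of_isOpen hX.isOpen (by norm_num))).mul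
        hu.contDiffOn))
    (fun I hI θ => by
      have h1 := hfp I hI θ
      have h2 := hu.periodic I hI θ
      simp only at h1 h2
      simp only [h1, h2])
    (fun I hI => by
      rw [phaseAvg_add (f := fun θ => f θ I - phaseAvg fun θ => f θ I)
        (g := fun θ => deriv Ω I * u θ I) ((hcont hf I hI).sub continuous_const)
        (continuous_const.mul (hcont hu.contDiffOn I hI)), hzero hf I hI, phaseAvg_const_mul,
        hu.avg_eq_zero I hI, mul_zero, add_zero])
  exact ⟨w, u, hw, hu, fun I hI θ => ⟨hsolve hw hwd I hI θ, hsolve hu hud I hI θ⟩⟩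

theorem periodic_projection (hX : IsGoodwinFamily m 𝓘 X Ω)
    (hd : ∀ I ∈ 𝓘, IsCycleDebt m X Ω I (fun θ => d₀ θ I)) {Z : ℝ → ℝ → Fin 2 → ℝ} {I : ℝ}
    (hI : I ∈ 𝓘) (hZ : Function.Periodic (fun θ => Z θ I) (2 * π)) :
    Function.Periodic (fun θ => Z θ I ⬝ᵥ cycleForcing m X d₀ θ I) (2 * π) := fun θ => by
  have h1 := hZ θ
  have h2 := hX.periodic_cycleForcing hd hI θ
  simp only at h1 h2
  simp only [h1, h2]

/-- First-order averaging of the phase--amplitude equation in near-identity variables. -/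
theorem exists_effective_equations (hX : IsGoodwinFamily m 𝓘 X Ω)
    (hd : ∀ I ∈ 𝓘, IsCycleDebt m X Ω I (fun θ => d₀ θ I))
    (hZθ : ∀ I ∈ 𝓘, IsPhaseMode m X Ω I (fun θ => ZI θ I) (fun θ => Zθ θ I))
    (hZI : ∀ I ∈ 𝓘, IsAmplitudeMode m X Ω I (fun θ => ZI θ I)) :
    ∃ w u : ℝ → ℝ → ℝ, IsCorrector 𝓘 w ∧ IsCorrector 𝓘 u ∧
      ∀ a b C : ℝ, Icc a b ⊆ 𝓘 → ∃ C' r₀ : ℝ, 0 < r₀ ∧ ∀ r : ℝ, |r| < r₀ →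
        InjOn (fun p : ℝ × ℝ => (p.1 - r * w p.1 p.2, p.2 - r * u p.1 p.2))
          (univ ×ˢ Icc a b) ∧
        ∀ (θ I : ℝ → ℝ) (s : Set ℝ), (∀ t ∈ s, I t ∈ Icc a b) →
          SolvesPhaseAmplitude m X Ω d₀ r C θ I s →
          ∀ ψ J : ℝ → ℝ, (∀ t, ψ t = θ t - r * w (θ t) (I t)) →
            (∀ t, J t = I t - r * u (θ t) (I t)) →
            ∀ t ∈ s, J t ∈ 𝓘 ∧ DifferentiableAt ℝ ψ t ∧ DifferentiableAt ℝ J t ∧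
              |deriv ψ t - (Ω (J t) + r * avgProjection m X d₀ Zθ (J t))| ≤ C' * r ^ 2 ∧
              |deriv J t - r * avgProjection m X d₀ ZI (J t)| ≤ C' * r ^ 2 := by
  have hG := hX.contDiffOn_cycleForcing hd
  have hf := (hX.contDiffOn_phaseMode hZθ hZI).dotProduct_two hG
  have hg := (hX.contDiffOn_amplitudeMode hZI).dotProduct_two hG
  set f : ℝ → ℝ → ℝ := fun θ I => Zθ θ I ⬝ᵥ cycleForcing m X d₀ θ I with hfdef
  set g : ℝ → ℝ → ℝ := fun θ I => ZI θ I ⬝ᵥ cycleForcing m X d₀ θ I with hgdef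
  have hfp : ∀ I ∈ 𝓘, Function.Periodic (fun θ => f θ I) (2 * π) := fun I hI =>
    hX.periodic_projection hd hI (hZθ I hI).2.1
  have hgp : ∀ I ∈ 𝓘, Function.Periodic (fun θ => g θ I) (2 * π) := fun I hI =>
    hX.periodic_projection hd hI (hZI I hI).2.1
  obtain ⟨w, u, hw, hu, hwu⟩ := hX.exists_averaging_correctors hf hfp hg hgp
  refine ⟨w, u, hw, hu, fun a b C hab => ?_⟩
  obtain ⟨c, hc, hproj⟩ := hX.exists_projection_bound (d₀ := d₀) hZθ hZI C hab
  obtain ⟨Bf, hBf, hBfb⟩ := exists_bound_of_periodic (f := f) hf.continuousOn hfp hab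
  obtain ⟨Bg, hBg, hBgb⟩ := exists_bound_of_periodic (f := g) hg.continuousOn hgp hab
  obtain ⟨Bu, hBu, hBub⟩ := exists_bound_of_periodic hu.contDiffOn.continuousOn hu.periodic hab
  obtain ⟨Lw, hLw, hLwb⟩ :=
    exists_fderiv_bound_of_periodic hX.isOpen hw.contDiffOn hw.periodic hab
  obtain ⟨Lu, hLu, hLub⟩ :=
    exists_fderiv_bound_of_periodic hX.isOpen hu.contDiffOn hu.periodic hab
  obtain ⟨T, ε₀, hT, hε₀, hTb⟩ :=
    exists_uniform_taylor hX.isOpen isCompact_Icc hab hX.contDiffOn_freq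
  obtain ⟨S₁, ε₁, hS₁, hε₁, hS₁b⟩ := exists_uniform_lipschitz hX.isOpen isCompact_Icc hab
    (f := avgProjection m X d₀ Zθ) (contDiffOn_phaseAvg (f := f) hX.isOpen hf)
  obtain ⟨S₂, ε₂, hS₂, hε₂, hS₂b⟩ := exists_uniform_lipschitz hX.isOpen isCompact_Icc hab
    (f := avgProjection m X d₀ ZI) (contDiffOn_phaseAvg (f := g) hX.isOpen hg)
  set B := max Bf Bg with hB
  set L := max Lw Lu with hL
  set S := max S₁ S₂ * Bu with hS
  set ε := min ε₀ (min ε₁ ε₂) with hε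
  have hεpos : 0 < ε := lt_min hε₀ (lt_min hε₁ hε₂)
  have hL0 : 0 ≤ L := hLw.trans (le_max_left _ _)
  have hB0 : 0 ≤ B := hBf.trans (le_max_left _ _)
  -- The amplitude shift is at most `Bu |r|`, which explains `T * Bu ^ 2` and `S`. The bounds on
  -- `r₀` keep this shift within all expansion radii and make the perturbation of the identity
  -- strictly contracting.
  refine ⟨c + T * Bu ^ 2 + S + 2 * (L * (B + c)), min 1 (min (ε / (Bu + 1)) (1 / (L + 1))),
    lt_min one_pos (lt_min (by positivity) (by positivity)), fun r hr => ?_⟩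
  have hr1 : |r| ≤ 1 := (hr.trans_le (min_le_left _ _)).le
  have hr' := hr.trans_le (min_le_right _ _)
  have hrε : |r| * (Bu + 1) ≤ ε :=
    (le_div_iff₀ (by positivity)).mp (hr'.trans_le (min_le_left _ _)).le
  have hrL : |r| * (L + 1) < 1 := (lt_div_iff₀ (by positivity)).mp (hr'.trans_le (min_le_right _ _))
  have hrL' : |r| * L < 1 :=
    (mul_le_mul_of_nonneg_left (by linarith) (abs_nonneg r)).trans_lt hrL
  refine ⟨injOn_near_identity (v := fun p => w p.1 p.2) (w := fun p => u p.1 p.2) hrL'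
    (fun p hp q hq => lipschitz_of_fderiv_bound hX.isOpen hw.contDiffOn hab
      (fun θ I hI => (hLwb θ I hI).trans (le_max_left _ _)) hp hq)
    (fun p hp q hq => lipschitz_of_fderiv_bound hX.isOpen hu.contDiffOn hab
      (fun θ I hI => (hLub θ I hI).trans (le_max_right _ _)) hp hq), ?_⟩
  intro θ I s hI hs ψ J hψ hJ t ht
  obtain ⟨hθd, hId, -⟩ := hs t ht
  have hIt := hI t ht
  have hI' := hab hIt
  obtain ⟨hρ₁, hρ₂⟩ := hproj r θ I s hI hs t ht
  obtain ⟨hwe, hue⟩ := hwu (I t) hI' (θ t)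
  set h := -(r * u (θ t) (I t)) with hh
  have hJt : J t = I t + h := by rw [hJ, hh, sub_eq_add_neg]
  have hub : |u (θ t) (I t)| ≤ Bu := hBub (θ t) (I t) hIt
  have hhr : |h| ≤ Bu * |r| := by
    rw [hh, abs_neg, abs_mul, mul_comm]
    exact mul_le_mul_of_nonneg_right hub (abs_nonneg r)
  have hhε : |h| ≤ ε := hhr.trans (le_trans (by linarith [abs_nonneg r]) hrε)
  obtain ⟨hmem, htay⟩ := hTb (I t) hIt h (hhε.trans (min_le_left _ _))
  have hl₁ := (hS₁b (I t) hIt h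
    (hhε.trans ((min_le_right _ _).trans (min_le_left _ _)))).2
  have hl₂ := (hS₂b (I t) hIt h
    (hhε.trans ((min_le_right _ _).trans (min_le_right _ _)))).2
  have hσ : ∀ {x y : ℝ}, |x| ≤ y * |h| → y ≤ max S₁ S₂ → |x| ≤ S * |r| := by
    intro x y hx hy
    refine hx.trans ((mul_le_mul hy hhr (abs_nonneg _) (hS₁.trans (le_max_left _ _))).trans ?_)
    rw [hS, mul_assoc]
  have hτ : |Ω (I t + h) - Ω (I t) - deriv Ω (I t) * h| ≤ T * Bu ^ 2 * r ^ 2 := by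
    refine htay.trans ?_
    rw [mul_assoc, ← mul_pow]
    refine mul_le_mul_of_nonneg_left ?_ hT
    rw [← sq_abs h, ← sq_abs (Bu * r), abs_mul Bu, abs_of_nonneg hBu]
    exact pow_le_pow_left₀ (abs_nonneg h) hhr 2
  have hpart : ∀ {v : ℝ → ℝ → ℝ}, IsCorrector 𝓘 v →
      (∀ θ, ∀ I ∈ Icc a b, ‖fderiv ℝ (fun p : ℝ × ℝ => v p.1 p.2) (θ, I)‖ ≤ L) →
      |fderiv ℝ (fun p : ℝ × ℝ => v p.1 p.2) (θ t, I t) (1, 0)| ≤ L ∧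
      |fderiv ℝ (fun p : ℝ × ℝ => v p.1 p.2) (θ t, I t) (0, 1)| ≤ L ∧
      HasDerivAt (fun t => v (θ t) (I t))
        (deriv θ t * fderiv ℝ (fun p : ℝ × ℝ => v p.1 p.2) (θ t, I t) (1, 0)
          + deriv I t * fderiv ℝ (fun p : ℝ × ℝ => v p.1 p.2) (θ t, I t) (0, 1)) t := by
    intro v hv hvL
    have hb := hvL (θ t) (I t) hIt
    refine ⟨?_, ?_, ?_⟩
    · exact (ContinuousLinearMap.le_of_opNorm_le _ hb (1, 0)).trans (by simp)
    · exact (ContinuousLinearMap.le_of_opNorm_le _ hb (0, 1)).trans (by simp)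
    · exact HasFDerivAt.hasDerivAt_curve (f := fun p : ℝ × ℝ => v p.1 p.2)
        ((hv.contDiffOn.contDiffAt (hX.isOpen_dom.mem_nhds
        (show (θ t, I t) ∈ _ from ⟨mem_univ _, hI'⟩))).differentiableAt
          one_ne_zero).hasFDerivAt hθd hId
  obtain ⟨hw1, hw2, hwd⟩ := hpart hw fun θ I hI => (hLwb θ I hI).trans (le_max_left _ _)
  obtain ⟨hu1, hu2, hud⟩ := hpart hu fun θ I hI => (hLub θ I hI).trans (le_max_right _ _)
  have hψd := hθd.hasDerivAt.fun_sub (hwd.const_mul r)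
  have hJd := hId.hasDerivAt.fun_sub (hud.const_mul r)
  rw [← funext hψ] at hψd
  rw [← funext hJ] at hJd
  have hfb : |f (θ t) (I t)| ≤ B := (hBfb (θ t) (I t) hIt).trans (le_max_left _ _)
  have hgb : |g (θ t) (I t)| ≤ B := (hBgb (θ t) (I t) hIt).trans (le_max_right _ _)
  have ea₁ : phaseAvg (fun φ => f φ (I t)) = avgProjection m X d₀ Zθ (I t) := rfl
  have ea₂ : phaseAvg (fun φ => g φ (I t)) = avgProjection m X d₀ ZI (I t) := rfl
  rw [ea₁] at hwe
  rw [ea₂] at hue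
  refine ⟨hJt ▸ hmem, hψd.differentiableAt, hJd.differentiableAt, ?_, ?_⟩
  · rw [hψd.deriv, hJt]
    refine le_of_eq_of_le (congrArg abs ?_) (abs_averaging_remainder_le hr1 hc hL0 hρ₁ hρ₁ hρ₂ hτ
      (hσ hl₁ (le_max_left _ _)) hw1 hw2 hfb hgb)
    simp only [hfdef, hgdef] at hwe ⊢
    -- The homological equation removes the oscillating part of `f`; `hh` matches `Ω' u` with the
    -- linear term of `Ω(I - r u)`.
    linear_combination -r * hwe - deriv Ω (I t) * hh
  · rw [hJd.deriv, hJt]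
    -- The amplitude has no zeroth-order drift, so there is no frequency expansion and `τ` is zero.
    refine le_of_eq_of_le (congrArg abs ?_) (abs_averaging_remainder_le (τ := 0)
      (T := T * Bu ^ 2) hr1 hc hL0 hρ₂ hρ₁ hρ₂ (by rw [abs_zero]; positivity)
      (hσ hl₂ (le_max_right _ _)) hu1 hu2 hfb hgb)
    simp only [hfdef, hgdef] at hue ⊢
    linear_combination -r * hue

end IsGoodwinFamily

end Goodwin

end

theorem mainTheorem3 (m : KeenModel) (𝓘 : Set ℝ) (X : ℝ → ℝ → Fin 2 → ℝ) (Ω : ℝ → ℝ)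
    (hX : IsGoodwinFamily m 𝓘 X Ω) :
    -- the debt component of each cycle and its adjoint modes are well defined
    (∀ I ∈ 𝓘, ∃! d : ℝ → ℝ, IsCycleDebt m X Ω I d) ∧
    (∀ I ∈ 𝓘, ∃! Z : (ℝ → Fin 2 → ℝ) × (ℝ → Fin 2 → ℝ),
      IsPhaseMode m X Ω I Z.2 Z.1 ∧ IsAmplitudeMode m X Ω I Z.2) ∧
    ∀ (d₀ : ℝ → ℝ → ℝ) (Zθ ZI : ℝ → ℝ → Fin 2 → ℝ),
      (∀ I ∈ 𝓘, IsCycleDebt m X Ω I (fun θ => d₀ θ I)) →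
      (∀ I ∈ 𝓘, IsPhaseMode m X Ω I (fun θ => ZI θ I) (fun θ => Zθ θ I)) →
      (∀ I ∈ 𝓘, IsAmplitudeMode m X Ω I (fun θ => ZI θ I)) →
      -- the Keen dynamics near the family obeys the phase--amplitude equation
      (∀ a b C : ℝ, Icc a b ⊆ 𝓘 → ∃ C' r₀ : ℝ, 0 < r₀ ∧ ∀ r : ℝ, |r| < r₀ →
        ∀ (θ I d : ℝ → ℝ) (s : Set ℝ), (∀ t ∈ s, I t ∈ Icc a b) →
          (∀ t ∈ s, DifferentiableAt ℝ θ t ∧ DifferentiableAt ℝ I t) →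
          SolvesKeen m r (fun t => X (θ t) (I t) 0) (fun t => X (θ t) (I t) 1) d s →
          (∀ t ∈ s, |d t - d₀ (θ t) (I t)| ≤ C * |r|) →
          SolvesPhaseAmplitude m X Ω d₀ r C' θ I s) ∧
      -- projection onto the adjoint modes
      (∀ a b C : ℝ, Icc a b ⊆ 𝓘 → ∃ C' : ℝ, ∀ (r : ℝ) (θ I : ℝ → ℝ) (s : Set ℝ),
        (∀ t ∈ s, I t ∈ Icc a b) → SolvesPhaseAmplitude m X Ω d₀ r C θ I s →
        ∀ t ∈ s,
          |deriv θ t - Ω (I t) - r * (Zθ (θ t) (I t) ⬝ᵥ cycleForcing m X d₀ (θ t) (I t))|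
            ≤ C' * r ^ 2 ∧
          |deriv I t - r * (ZI (θ t) (I t) ⬝ᵥ cycleForcing m X d₀ (θ t) (I t))|
            ≤ C' * r ^ 2) ∧
      -- averaging over the phase: the effective equations, in near-identity variables
      (∃ w u : ℝ → ℝ → ℝ, IsCorrector 𝓘 w ∧ IsCorrector 𝓘 u ∧
        ∀ a b C : ℝ, Icc a b ⊆ 𝓘 → ∃ C' r₀ : ℝ, 0 < r₀ ∧ ∀ r : ℝ, |r| < r₀ →
          InjOn (fun p : ℝ × ℝ => (p.1 - r * w p.1 p.2, p.2 - r * u p.1 p.2))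
            (univ ×ˢ Icc a b) ∧
          ∀ (θ I : ℝ → ℝ) (s : Set ℝ), (∀ t ∈ s, I t ∈ Icc a b) →
            SolvesPhaseAmplitude m X Ω d₀ r C θ I s →
            ∀ ψ J : ℝ → ℝ, (∀ t, ψ t = θ t - r * w (θ t) (I t)) →
              (∀ t, J t = I t - r * u (θ t) (I t)) →
              ∀ t ∈ s, J t ∈ 𝓘 ∧ DifferentiableAt ℝ ψ t ∧ DifferentiableAt ℝ J t ∧
                |deriv ψ t - (Ω (J t) + r * avgProjection m X d₀ Zθ (J t))| ≤ C' * r ^ 2 ∧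
                |deriv J t - r * avgProjection m X d₀ ZI (J t)| ≤ C' * r ^ 2) := by
  refine ⟨fun I hI => hX.existsUnique_cycleDebt hI, fun I hI => hX.existsUnique_modes hI, ?_⟩
  intro d₀ Zθ ZI hd hZθ hZI
  refine ⟨fun a b C hab => hX.exists_phaseAmplitude_remainder hd C hab, fun a b C hab => ?_,
    hX.exists_effective_equations hd hZθ hZI⟩
  obtain ⟨C', -, h⟩ := hX.exists_projection_bound (d₀ := d₀) hZθ hZI C hab
  exact ⟨C', h⟩
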